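/- Let $M$ be a smooth $n$-dimensional manifold with tangent bundle $\pi:TM\to M$. A *pseudo-Finsler metric* on $M$ is a smooth function $L:A\to\mathbb R$, where $A\subset TM\setminus\mathbf 0$ is open, $\pi(A)=M$ and $\lambda v\in A$ for $v\in A$, $\lambda>0$, such that $L(\lambda v)=\lambda^2L(v)$ for $v\in A$, $\lambda>0$, and such that for every $v\in A$ the fundamental tensor $$g_v(u,w)=\tfrac12\,\tfrac{\partial^2}{\partial t\,\partial s}L(v+tu+sw)\big|_{t=s=0},\qquad u,w\in T_{\pi(v)}M,$$ is nondegenerate. Its Cartan tensor is $C_v(w_1,w_2,w_3)=\tfrac14\,\tfrac{\partial^3}{\partial s_3\partial s_2\partial s_1}L\big(v+\sum_i s_iw_i\big)\big|_{s=0}$. A vector field, or a vector field along a curve, is *$L$-admissible* if it takes values in $A$; a curve is $L$-admissible if its velocity is. For an $L$-admissible smooth vector field $V$ on an open set $\Omega\subset M$, let $\nabla^V$ be the Chern connection associated to $V$, that is, the torsion-free affine connection on $\Omega$ with $$X(g_V(Y,Z))=g_V(\nabla^V_XY,Z)+g_V(Y,\nabla^V_XZ)+2C_V(\nabla^V_XV,Y,Z).$$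 In a chart its Christoffel symbols are $\Gamma^k_{ij}\circ V$ with functions $\Gamma^k_{ij}$ on the part of $A$ over the chart domain that do not depend on $V$. Let $R^V(X,Y)Z=\nabla^V_X\nabla^V_YZ-\nabla^V_Y\nabla^V_XZ-\nabla^V_{[X,Y]}Z$, let $$\nabla^V_XC_V(Y,Z,W)=X(C_V(Y,Z,W))-C_V(\nabla^V_XY,Z,W)-C_V(Y,\nabla^V_XZ,W)-C_V(Y,Z,\nabla^V_XW),$$ and let $$B^V(X,Y,Z,W)=\nabla^V_YC_V(\nabla^V_XV,Z,W)-\nabla^V_XC_V(\nabla^V_YV,Z,W)+C_V(R^V(Y,X)V,Z,W).$$ Let $\gamma:[a,b]\to M$, $a<b$, be a smooth $L$-admissible curve and let $U,Z$ be smooth vector fields along $\gamma$. Let $\Lambda:[a,b]\times(-\varepsilon,\varepsilon)\to M$ be a smooth variation of $\gamma$ with variational field $U$, that is, $\Lambda(t,0)=\gamma(t)$ and $\Lambda_s(t,0)=U(t)$, all of whose curves $\gamma_s=\Lambda(\cdot,s)$ are $L$-admissible; put $\beta_t=\Lambda(t,\cdot)$, and let $\tilde Z$ be a smooth vector field along $\Lambda$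 with $\tilde Z(t,0)=Z(t)$. Then $$R^\gamma(\dot\gamma,U)Z=\big(D^{\Lambda_t}_{\gamma_s}D^{\Lambda_t}_{\beta_t}\tilde Z-D^{\Lambda_t}_{\beta_t}D^{\Lambda_t}_{\gamma_s}\tilde Z\big)\big|_{s=0},$$ where, for a curve $c$ and vector fields $T,X$ along $c$ with $T$ $L$-admissible, the covariant derivative $D^T_cX$ is given in a chart by $(D^T_cX)^k=\dot X^k+\sum_{i,j}X^i\dot c^j\,\Gamma^k_{ij}(T)$. **Lemma.** Let $(M,L)$ be a pseudo-Finsler manifold, $\Omega\subset M$ open, and $V$ an $L$-admissible smooth vector field on $\Omega$. Then for all smooth vector fields $X,Y,Z,W$ on $\Omega$: (i) if $Z=V$ or $W=V$, then $B^V(X,Y,Z,W)=0$; (ii) if at least two of $X,Y,Z,W$ are equal to $V$, then $B^V(X,Y,Z,W)=0$. (iii) For every smooth $L$-admissible curve $\gamma:[a,b]\to M$ and all smooth vector fields $U,P$ along $\gamma$, $$g_{\dot\gamma}(R^\gamma(\dot\gamma,U)\dot\gamma,P)=-g_{\dot\gamma}(R^\gamma(\dot\gamma,U)P,\dot\gamma)\quad\text{on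 }[a,b],$$ whichever variations and extensions are used to compute the two sides. -/

import Mathlib

open Set Bundle
open scoped Manifold ContDiff Topology

namespace FinslerGeom

noncomputable section

/-! ### Multilinear algebra in one fibre / in one coordinate chart -/

section Local

variable {E : Type*} [NormedAddCommGroup E] [NormedSpace ℝ E]

/-- For `f = L` restricted to one tangent space: the bilinear form
`g_v(u, w) = 1/2 ∂²/∂t∂s L(v + t u + s w)` at `t = s = 0`, i.e. half the second differential. -/
def fiberMetric (f : E → ℝ) (v : E) : E →L[ℝ] E →L[ℝ] ℝ :=
  (1 / 2 : ℝ) • fderiv ℝ (fderiv ℝ f) v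

/-- For `f = L` restricted to one tangent space: the trilinear form
`C_v(w₁, w₂, w₃) = 1/4 ∂³/∂s₃∂s₂∂s₁ L(v + s₁ w₁ + s₂ w₂ + s₃ w₃)` at `s = 0`, i.e. a quarter of
the third differential. -/
def fiberCartan (f : E → ℝ) (v : E) : E →L[ℝ] E →L[ℝ] E →L[ℝ] ℝ :=
  (1 / 4 : ℝ) • fderiv ℝ (fderiv ℝ (fderiv ℝ f)) v

set_option synthInstance.maxHeartbeats 100000 in
/-- Let `ℓ x y` be the expression of `L` in coordinates (`x` the base point, `y` the components of
a tangent vector at `x`). The derivative of the fundamental tensor in the base point: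
`baseDeriv ℓ x y X u w = ∑ Xᵏ uⁱ wʲ ∂g_ij/∂xᵏ (x, y)`. -/
def baseDeriv (ℓ : E → E → ℝ) (x y : E) : E →L[ℝ] E →L[ℝ] E →L[ℝ] ℝ :=
  fderiv ℝ (fun x' => fiberMetric (ℓ x') y) x

/-- Raising an index: the inverse `T_x^* → T_x` of `u ↦ g_y(u, ·)`. -/
def sharp (ℓ : E → E → ℝ) (x y : E) : (E →L[ℝ] ℝ) →L[ℝ] E :=
  (fiberMetric (ℓ x) y).inverse

/-- The vector `Γ(y, y)`, where `Γ` are the Christoffel symbols at `(x, y)`: it solves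
`g_y(Γ(y,y), Z) = (∂_y g)(y, Z) - 1/2 (∂_Z g)(y, y)` for all `Z`. -/
def chernSpray (ℓ : E → E → ℝ) (x y : E) : E :=
  sharp ℓ x y (baseDeriv ℓ x y y y - (1 / 2 : ℝ) • ((baseDeriv ℓ x y).flip y).flip y)

/-- The linear map `X ↦ Γ(X, y)` (the nonlinear connection): it solves
`g_y(Γ(X,y), Z) = 1/2 ((∂_X g)(y, Z) + (∂_y g)(X, Z) - (∂_Z g)(X, y)) - C_y(Γ(y,y), X, Z)`. -/
def chernNonlinear (ℓ : E → E → ℝ) (x y : E) : E →L[ℝ] E :=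
  (sharp ℓ x y).comp
    ((1 / 2 : ℝ) • ((baseDeriv ℓ x y).flip y + baseDeriv ℓ x y y
        - ((baseDeriv ℓ x y).flip y).flip)
      - fiberCartan (ℓ x) y (chernSpray ℓ x y))

/-- The Christoffel symbols of the Chern connection at `(x, y)`, as the bilinear map
`(X, Y) ↦ ∑ Xⁱ Yʲ Γᵏ_ij(x, y) e_k`. Writing `N X = Γ(X, y)`, it solves the Koszul-type formula
`g_y(Γ(X,Y), Z) = 1/2 ((∂_X g)(Y,Z) + (∂_Y g)(X,Z) - (∂_Z g)(X,Y))
    - C_y(N X, Y, Z) - C_y(N Y, X, Z) + C_y(N Z, X, Y)`,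
i.e. it is the only symmetric bilinear map with
`(∂_X g)(Y,Z) = g_y(Γ(X,Y), Z) + g_y(Y, Γ(X,Z)) + 2 C_y(Γ(X,y), Y, Z)`;
these two conditions are torsion-freeness and almost `g`-compatibility in coordinates. -/
def christoffel (ℓ : E → E → ℝ) (x y X Y : E) : E :=
  sharp ℓ x y
    ((1 / 2 : ℝ) • (baseDeriv ℓ x y X Y + baseDeriv ℓ x y Y X
        - ((baseDeriv ℓ x y).flip X).flip Y)
      - fiberCartan (ℓ x) y (chernNonlinear ℓ x y X) Y
      - fiberCartan (ℓ x) y (chernNonlinear ℓ x y Y) X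
      + (fiberCartan (ℓ x) y X Y).comp (chernNonlinear ℓ x y))

/-- Coordinate expression of the covariant derivative of `z` with reference vector `w` along the
curve `x`, defined on the interval `J`: `dz/dt + ∑ zⁱ (dxʲ/dt) Γᵏ_ij(x, w) e_k`. -/
def covDerivCoord (ℓ : E → E → ℝ) (J : Set ℝ) (x w z : ℝ → E) (t : ℝ) : E :=
  derivWithin z J t + christoffel ℓ (x t) (w t) (z t) (derivWithin x J t)

end Local

/-! ### Pseudo-Finsler metrics -/

/-- A (conic, two-homogeneous) pseudo-Finsler metric `L : A → ℝ` on a manifold `M` modelled on `E`.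
The values of `L` outside of the conic domain `A` are irrelevant. -/
structure PseudoFinsler (E : Type*) [NormedAddCommGroup E] [NormedSpace ℝ E]
    (M : Type*) [TopologicalSpace M] [ChartedSpace E M] [IsManifold 𝓘(ℝ, E) ∞ M] where
  /-- the conic domain -/
  A : Set (TangentBundle 𝓘(ℝ, E) M)
  /-- the metric -/
  L : TangentBundle 𝓘(ℝ, E) M → ℝ
  isOpen_A : IsOpen A
  zero_notMem : ∀ p : M, (⟨p, 0⟩ : TangentBundle 𝓘(ℝ, E) M) ∉ A
  proj_surj : ∀ p : M, ∃ v : TangentSpace 𝓘(ℝ, E) p, (⟨p, v⟩ : TangentBundle 𝓘(ℝ, E) M) ∈ A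
  conic : ∀ (p : M) (v : TangentSpace 𝓘(ℝ, E) p) (c : ℝ), 0 < c →
    (⟨p, v⟩ : TangentBundle 𝓘(ℝ, E) M) ∈ A → (⟨p, c • v⟩ : TangentBundle 𝓘(ℝ, E) M) ∈ A
  smooth : ContMDiffOn 𝓘(ℝ, E).tangent 𝓘(ℝ, ℝ) ∞ L A
  homogeneous : ∀ (p : M) (v : TangentSpace 𝓘(ℝ, E) p) (c : ℝ), 0 < c →
    (⟨p, v⟩ : TangentBundle 𝓘(ℝ, E) M) ∈ A → L ⟨p, c • v⟩ = c ^ 2 * L ⟨p, v⟩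
  nondegenerate : ∀ (p : M) (v : TangentSpace 𝓘(ℝ, E) p),
    (⟨p, v⟩ : TangentBundle 𝓘(ℝ, E) M) ∈ A → ∀ u : E,
      (∀ w : E, fiberMetric (fun y : E => L ⟨p, y⟩) v u w = 0) → u = 0

variable {E : Type*} [NormedAddCommGroup E] [NormedSpace ℝ E]
  {M : Type*} [TopologicalSpace M] [ChartedSpace E M] [IsManifold 𝓘(ℝ, E) ∞ M]

/-- Components of a tangent vector with respect to the coordinates given by the preferred chart
at `p`. -/
def comps (p : M) (v : TangentBundle 𝓘(ℝ, E) M) : E :=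
  (trivializationAt E (TangentSpace 𝓘(ℝ, E)) p v).2

/-- The tangent vector at `q` with given components in the preferred chart at `p`. -/
def ofComps (p q : M) (y : E) : TangentSpace 𝓘(ℝ, E) q :=
  (trivializationAt E (TangentSpace 𝓘(ℝ, E)) p).symm q y

/-- The directional derivative `X(f)` of a function `f : M → G` at `p`, for `X ∈ T_p M`. -/
def dirDeriv {G : Type*} [NormedAddCommGroup G] [NormedSpace ℝ G] (f : M → G) (p : M)
    (X : TangentSpace 𝓘(ℝ, E) p) : G :=
  mfderiv 𝓘(ℝ, E) 𝓘(ℝ, G) f p X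

namespace PseudoFinsler

variable (F : PseudoFinsler E M)

/-- The fundamental tensor `g_v(u, w)`, for `v, u, w ∈ T_p M`. -/
def g {p : M} (v u w : TangentSpace 𝓘(ℝ, E) p) : ℝ :=
  fiberMetric (fun y : E => F.L ⟨p, y⟩) v u w

/-- The Cartan tensor `C_v(w₁, w₂, w₃)`, for `v, w₁, w₂, w₃ ∈ T_p M`. -/
def C {p : M} (v w₁ w₂ w₃ : TangentSpace 𝓘(ℝ, E) p) : ℝ :=
  fiberCartan (fun y : E => F.L ⟨p, y⟩) v w₁ w₂ w₃

/-- `L` in the coordinates of the preferred chart at `p`. -/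
def coordL (p : M) (x y : E) : ℝ :=
  F.L ⟨(extChartAt 𝓘(ℝ, E) p).symm x, ofComps p ((extChartAt 𝓘(ℝ, E) p).symm x) y⟩

/-- The Chern connection `∇^V_X Y` associated to the vector field `V`. Its value at `p` is computed
in the preferred chart at `p`: `∑ (X(Yᵏ) + Xⁱ Yʲ Γᵏ_ij(V)) ∂_k`. -/
def nabla (V X Y : ∀ p : M, TangentSpace 𝓘(ℝ, E) p) (p : M) : TangentSpace 𝓘(ℝ, E) p :=
  ofComps p p
    (dirDeriv (fun q => comps p ⟨q, Y q⟩) p (X p)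
      + christoffel (F.coordL p) (extChartAt 𝓘(ℝ, E) p p)
          (comps p ⟨p, V p⟩) (comps p ⟨p, X p⟩) (comps p ⟨p, Y p⟩))

/-- The curvature `R^V(X, Y) Z = ∇_X ∇_Y Z - ∇_Y ∇_X Z - ∇_[X,Y] Z` of `∇ = ∇^V`. -/
def curv (V X Y Z : ∀ p : M, TangentSpace 𝓘(ℝ, E) p) (p : M) : TangentSpace 𝓘(ℝ, E) p :=
  F.nabla V X (F.nabla V Y Z) p - F.nabla V Y (F.nabla V X Z) p
    - F.nabla V (VectorField.mlieBracket 𝓘(ℝ, E) X Y) Z p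

/-- The covariant derivative `(∇^V_X C_V)(Y, Z, W)` of the Cartan tensor. -/
def nablaCartan (V X Y Z W : ∀ p : M, TangentSpace 𝓘(ℝ, E) p) (p : M) : ℝ :=
  dirDeriv (fun q => F.C (V q) (Y q) (Z q) (W q)) p (X p)
    - F.C (V p) (F.nabla V X Y p) (Z p) (W p)
    - F.C (V p) (Y p) (F.nabla V X Z p) (W p)
    - F.C (V p) (Y p) (Z p) (F.nabla V X W p)

/-- The tensor `B^V(X, Y, Z, W) = (∇_Y C_V)(∇_X V, Z, W) - (∇_X C_V)(∇_Y V, Z, W)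
+ C_V(R^V(Y, X) V, Z, W)`, with `∇ = ∇^V`. -/
def B (V X Y Z W : ∀ p : M, TangentSpace 𝓘(ℝ, E) p) (p : M) : ℝ :=
  F.nablaCartan V Y (F.nabla V X V) Z W p - F.nablaCartan V X (F.nabla V Y V) Z W p
    + F.C (V p) (F.curv V Y X V p) (Z p) (W p)

end PseudoFinsler

/-! ### Vector fields, curves and variations -/

/-- Smooth vector fields on an open set `Ω` (values outside of `Ω` are irrelevant). -/
def SmoothField (Ω : Set M) (X : ∀ p : M, TangentSpace 𝓘(ℝ, E) p) : Prop :=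
  ContMDiffOn 𝓘(ℝ, E) 𝓘(ℝ, E).tangent ∞ (fun p => (⟨p, X p⟩ : TangentBundle 𝓘(ℝ, E) M)) Ω

/-- Smooth vector fields along a curve `γ : [a, b] → M`. -/
def SmoothFieldAlong (a b : ℝ) (γ : ℝ → M) (X : ∀ t : ℝ, TangentSpace 𝓘(ℝ, E) (γ t)) : Prop :=
  ContMDiffOn 𝓘(ℝ, ℝ) 𝓘(ℝ, E).tangent ∞
    (fun t => (⟨γ t, X t⟩ : TangentBundle 𝓘(ℝ, E) M)) (Icc a b)

/-- The velocity of a curve `γ : [a, b] → M` (one-sided at the end points). -/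
def velocity (a b : ℝ) (γ : ℝ → M) (t : ℝ) : TangentSpace 𝓘(ℝ, E) (γ t) :=
  mfderivWithin 𝓘(ℝ, ℝ) 𝓘(ℝ, E) γ (Icc a b) t (1 : ℝ)

/-- For a two-parameter map `Λ`, the velocity `Λ_s` of the transverse curves `s ↦ Λ(t, s)`. -/
def transverse (Λ : ℝ → ℝ → M) (t s : ℝ) : TangentSpace 𝓘(ℝ, E) (Λ t s) :=
  mfderiv 𝓘(ℝ, ℝ) 𝓘(ℝ, E) (fun s' => Λ t s') s (1 : ℝ)

namespace PseudoFinsler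

variable (F : PseudoFinsler E M)

/-- A smooth `L`-admissible curve `γ : [a, b] → M`. -/
def AdmissibleCurve (a b : ℝ) (γ : ℝ → M) : Prop :=
  ContMDiffOn 𝓘(ℝ, ℝ) 𝓘(ℝ, E) ∞ γ (Icc a b) ∧
    ∀ t ∈ Icc a b, (⟨γ t, velocity a b γ t⟩ : TangentBundle 𝓘(ℝ, E) M) ∈ F.A

/-- `R^Λ(Z) = D_{γ_s} D_{β_t} Z - D_{β_t} D_{γ_s} Z`, for a vector field `Z` along
`Λ : [a, b] × (-ε, ε) → M`, where the covariant derivatives along the longitudinal curves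
`γ_s = Λ(·, s)` and the transverse curves `β_t = Λ(t, ·)` have reference vector `Λ_t`. The value at
`(t, s)` is computed in one coordinate system around `Λ(t, s)`, the preferred chart there. -/
def curvVariation (a b ε : ℝ) (Λ : ℝ → ℝ → M) (Z : ∀ t s : ℝ, TangentSpace 𝓘(ℝ, E) (Λ t s))
    (t s : ℝ) : TangentSpace 𝓘(ℝ, E) (Λ t s) :=
  let p : M := Λ t s
  let x : ℝ → ℝ → E := fun t' s' => extChartAt 𝓘(ℝ, E) p (Λ t' s')
  let w : ℝ → ℝ → E := fun t' s' => comps p ⟨Λ t' s', velocity a b (fun τ => Λ τ s') t'⟩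
  let z : ℝ → ℝ → E := fun t' s' => comps p ⟨Λ t' s', Z t' s'⟩
  let Dγ : (ℝ → ℝ → E) → ℝ → ℝ → E := fun ζ t' s' =>
    covDerivCoord (F.coordL p) (Icc a b) (fun τ => x τ s') (fun τ => w τ s') (fun τ => ζ τ s') t'
  let Dβ : (ℝ → ℝ → E) → ℝ → ℝ → E := fun ζ t' s' =>
    covDerivCoord (F.coordL p) (Ioo (-ε) ε) (x t') (w t') (ζ t') s'
  ofComps p p (Dγ (Dβ z) t s - Dβ (Dγ z) t s)

/-- `R` is the vector field `R^γ(γ', U) Z` along `γ : [a, b] → M`: there are a smooth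
`L`-admissible variation `Λ : [a, b] × (-ε, ε) → M` of `γ` with variational vector field `U` and a
smooth extension `Z'` of `Z` to `Λ` such that `R = R^Λ(Z')` along `γ`. -/
def IsCurvAlong (a b : ℝ) (γ : ℝ → M) (U Z R : ∀ t : ℝ, TangentSpace 𝓘(ℝ, E) (γ t)) : Prop :=
  ∃ (ε : ℝ) (Λ : ℝ → ℝ → M) (Z' : ∀ t s : ℝ, TangentSpace 𝓘(ℝ, E) (Λ t s)),
    0 < ε ∧
    ContMDiffOn 𝓘(ℝ, ℝ × ℝ) 𝓘(ℝ, E) ∞ (fun q : ℝ × ℝ => Λ q.1 q.2) (Icc a b ×ˢ Ioo (-ε) ε) ∧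
    ContMDiffOn 𝓘(ℝ, ℝ × ℝ) 𝓘(ℝ, E).tangent ∞
      (fun q : ℝ × ℝ => (⟨Λ q.1 q.2, Z' q.1 q.2⟩ : TangentBundle 𝓘(ℝ, E) M))
      (Icc a b ×ˢ Ioo (-ε) ε) ∧
    (∀ s ∈ Ioo (-ε) ε, F.AdmissibleCurve a b (fun t => Λ t s)) ∧
    ∀ t ∈ Icc a b,
      (⟨Λ t 0, transverse Λ t 0⟩ : TangentBundle 𝓘(ℝ, E) M) = ⟨γ t, U t⟩ ∧
      (⟨Λ t 0, Z' t 0⟩ : TangentBundle 𝓘(ℝ, E) M) = ⟨γ t, Z t⟩ ∧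
      (⟨Λ t 0, F.curvVariation a b ε Λ Z' t 0⟩ : TangentBundle 𝓘(ℝ, E) M) = ⟨γ t, R t⟩

end PseudoFinsler

end

end FinslerGeom

set_option synthInstance.maxHeartbeats 200000

namespace FinslerGeom

/-! Everything rests on two facts about the Cartan tensor. It is totally symmetric, because it is a
third derivative, and `C_v(v, ·, ·) = 0`, because the Hessian of a two-homogeneous function is
homogeneous of degree zero.

For (i), suppose `W = V`. Then `C_V(·, ·, W)` vanishes identically on `Ω`, so `(∇_X C_V)(Y, Z, V)`
reduces to `-C_V(Y, Z, ∇_X V)`. The first two terms of `B` become `-C_V(∇_X V, Z, ∇_Y V)` and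
`C_V(∇_Y V, Z, ∇_X V)`, which cancel by symmetry, and the curvature term has `V` in its last slot
(`B_self_right`). The case `Z = V` follows from symmetry in the last two arguments. For (ii), two
positions out of four either include `Z` or `W`, or are `X` and `Y`; when `X = Y` the terms of `B`
cancel because `B` is skew in its first two arguments (`B_self_left`). Neither part uses
compatibility with the metric.

For (iii), work in the chart at `γ t`. The Koszul-type formula yields almost compatibility
(`baseDeriv_eq`), hence a product rule for `g_w(z₁, z₂)` along curves with correction `2 C_w(D w,
z₁, z₂)` (`hasDerivWithinAt_metric`). The correction is absent for `g_w(w, z)`. Differentiating this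
function once in each parameter and equating the mixed partials, the remaining corrections `2
C_w(D_t w, D_s w, z)` agree by symmetry, and what is left is skew-symmetry of the commutator
(`metric_commutator`).

Independence of the choices comes from `covDeriv_commutator`: the commutator involves only `z`
itself and first derivatives of the base point `x` and of the reference vector `w`. Since `w = ∂_t
x`, its transverse derivative is `∂_t ∂_s x`, the derivative of the components of `U`. Thus `γ`, `U`
and `Z` determine the curvature (`IsCurvAlong.coord`). -/

theorem ofNat_le_infty (n : ℕ∞) : (n : WithTop ℕ∞) ≤ ∞ :=
  WithTop.coe_le_coe.2 le_top

/-! ### Normed structures on bilinear and trilinear forms -/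

section Instances

variable {E : Type*} [NormedAddCommGroup E] [NormedSpace ℝ E]

noncomputable instance instNormedAddCommGroupBilin : NormedAddCommGroup (E →L[ℝ] E →L[ℝ] ℝ) :=
  ContinuousLinearMap.toNormedAddCommGroup

noncomputable instance instNormedSpaceBilin : NormedSpace ℝ (E →L[ℝ] E →L[ℝ] ℝ) :=
  ContinuousLinearMap.toNormedSpace

noncomputable instance instNormedAddCommGroupTrilin :
    NormedAddCommGroup (E →L[ℝ] E →L[ℝ] E →L[ℝ] ℝ) :=
  ContinuousLinearMap.toNormedAddCommGroup

noncomputable instance instNormedSpaceTrilin : NormedSpace ℝ (E →L[ℝ] E →L[ℝ] E →L[ℝ] ℝ) :=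
  ContinuousLinearMap.toNormedSpace

end Instances

/-! ### Symmetry and homogeneity of the vertical derivatives -/

section Vertical

variable {E : Type*} [NormedAddCommGroup E] [NormedSpace ℝ E]

theorem fiberMetric_symm {f : E → ℝ} {y : E} (hf : ContDiffAt ℝ ∞ f y) (u w : E) :
    fiberMetric f y u w = fiberMetric f y w u := by
  have h := hf.isSymmSndFDerivAt (by simpa using ofNat_le_infty 2)
  simp only [fiberMetric, smul_apply]
  rw [h.eq u w]

theorem contDiffAt_fderiv_infty {G : Type*} [NormedAddCommGroup G] [NormedSpace ℝ G] {f : E → G}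
    {y : E} (hf : ContDiffAt ℝ ∞ f y) : ContDiffAt ℝ ∞ (fderiv ℝ f) y :=
  hf.fderiv_right (by simp)

/-- Smoothness of infinite order at a point need not persist on one neighbourhood, since the
neighbourhoods may shrink with the order. A fixed finite order does persist, and order three is
enough for symmetry of the Hessian nearby. -/
theorem ContDiffAt.eventually_infty {G : Type*} [NormedAddCommGroup G] [NormedSpace ℝ G]
    {f : E → G} {y : E} (hf : ContDiffAt ℝ ∞ f y) : ∀ᶠ z in 𝓝 y, ContDiffAt ℝ 3 f z :=
  (hf.of_le (ofNat_le_infty 3) : ContDiffAt ℝ 3 f y).eventually (by simp)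

theorem fiberMetric_eventually_symm {f : E → ℝ} {y : E} (hf : ContDiffAt ℝ ∞ f y) (u w : E) :
    (fun z => fderiv ℝ (fderiv ℝ f) z u w) =ᶠ[𝓝 y] fun z => fderiv ℝ (fderiv ℝ f) z w u := by
  filter_upwards [ContDiffAt.eventually_infty hf] with z hz
  exact (hz.isSymmSndFDerivAt (by simp; norm_cast)).eq u w

theorem fderiv_apply_apply {G : Type*} [NormedAddCommGroup G] [NormedSpace ℝ G]
    {Φ : G → E →L[ℝ] E →L[ℝ] ℝ} {y : G} (h : DifferentiableAt ℝ Φ y) (ξ : G) (u w : E) :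
    fderiv ℝ Φ y ξ u w = fderiv ℝ (fun z => Φ z u w) y ξ := by
  have h1 := ((h.hasFDerivAt.clm_apply (hasFDerivAt_const u y)).clm_apply (hasFDerivAt_const w y))
  rw [h1.fderiv]
  simp

/-- The Hessian is symmetric on a whole neighbourhood of `y`, so this symmetry can be
differentiated. Together with `fiberCartan_symm_left`, which is Schwarz's theorem for `fderiv ℝ f`,
it generates all permutations of the arguments. -/
theorem fiberCartan_symm_right {f : E → ℝ} {y : E} (hf : ContDiffAt ℝ ∞ f y) (u v w : E) :
    fiberCartan f y u v w = fiberCartan f y u w v := by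
  have hd : DifferentiableAt ℝ (fderiv ℝ (fderiv ℝ f)) y :=
    (contDiffAt_fderiv_infty (contDiffAt_fderiv_infty hf)).differentiableAt (by simp)
  simp only [fiberCartan, smul_apply]
  rw [fderiv_apply_apply hd, fderiv_apply_apply hd, (fiberMetric_eventually_symm hf v w).fderiv_eq]

theorem fiberCartan_symm_left {f : E → ℝ} {y : E} (hf : ContDiffAt ℝ ∞ f y) (u v w : E) :
    fiberCartan f y u v w = fiberCartan f y v u w := by
  have h := (contDiffAt_fderiv_infty hf).isSymmSndFDerivAt (by simpa using ofNat_le_infty 2)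
  simp only [fiberCartan, smul_apply]
  rw [h.eq u v]

/-- The Cartan tensor of a two-homogeneous function vanishes in the radial direction. -/
theorem fiberCartan_self {f : E → ℝ} {s : Set E} (hs : IsOpen s) (hf : ContDiffOn ℝ ∞ f s)
    (hom : ∀ y ∈ s, ∀ c : ℝ, 0 < c → f (c • y) = c ^ 2 * f y)
    {y : E} (hy : y ∈ s) : fiberCartan f y y = 0 := by
  -- Each differentiation lowers the degree of homogeneity by one: the chain rule produces a factor
  -- `c` that is cancelled. The differential has degree one and the Hessian degree zero.
  have h1 : ∀ z ∈ s, ∀ c : ℝ, 0 < c → fderiv ℝ f (c • z) = c • fderiv ℝ f z := by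
    intro z hz c hc
    have e : (fun z => f (c • z)) =ᶠ[𝓝 z] fun z => c ^ 2 • f z := by
      filter_upwards [hs.mem_nhds hz] with z' hz' using hom z' hz' c hc
    have := e.fderiv_eq (𝕜 := ℝ)
    rw [_root_.fderiv_comp_smul, fderiv_fun_const_smul
      ((hf.contDiffAt (hs.mem_nhds hz)).differentiableAt (by simp))] at this
    rw [pow_two, mul_smul] at this
    exact smul_right_injective _ hc.ne' this
  have hf1 : ∀ z ∈ s, ContDiffAt ℝ ∞ (fderiv ℝ f) z := fun z hz =>
    contDiffAt_fderiv_infty (hf.contDiffAt (hs.mem_nhds hz))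
  have h2 : ∀ z ∈ s, ∀ c : ℝ, 0 < c →
      fderiv ℝ (fderiv ℝ f) (c • z) = fderiv ℝ (fderiv ℝ f) z := by
    intro z hz c hc
    have e : (fun z => fderiv ℝ f (c • z)) =ᶠ[𝓝 z] fun z => c • fderiv ℝ f z := by
      filter_upwards [hs.mem_nhds hz] with z' hz' using h1 z' hz' c hc
    have := e.fderiv_eq (𝕜 := ℝ)
    rw [_root_.fderiv_comp_smul, fderiv_fun_const_smul ((hf1 z hz).differentiableAt (by simp))] at this
    exact smul_right_injective _ hc.ne' this
  have hd : HasFDerivAt (fderiv ℝ (fderiv ℝ f)) (fderiv ℝ (fderiv ℝ (fderiv ℝ f)) y)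
      (id (1 : ℝ) • y) := by
    rw [id, one_smul]
    exact ((contDiffAt_fderiv_infty (hf1 y hy)).differentiableAt (by simp)).hasFDerivAt
  -- Euler's argument: the derivative at `c = 1` of the Hessian along the ray through `y` is the
  -- third differential contracted with `y`, while by `h2` the Hessian is constant on that ray.
  have h3 : HasDerivAt (fun c : ℝ => fderiv ℝ (fderiv ℝ f) (c • y))
      (fderiv ℝ (fderiv ℝ (fderiv ℝ f)) y y) 1 := by
    have := HasFDerivAt.comp_hasDerivAt (l := fderiv ℝ (fderiv ℝ f)) (f := fun c : ℝ => id c • y)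
      (1 : ℝ) hd ((hasDerivAt_id (1 : ℝ)).smul_const y)
    simpa [Function.comp_def] using this
  have h4 : HasDerivAt (fun c : ℝ => fderiv ℝ (fderiv ℝ f) (c • y)) 0 1 := by
    refine (hasDerivAt_const (1 : ℝ) (fderiv ℝ (fderiv ℝ f) y)).congr_of_eventuallyEq ?_
    filter_upwards [lt_mem_nhds (zero_lt_one' ℝ)] with c hc using h2 y hy c hc
  simp only [fiberCartan, smul_apply]
  rw [h3.unique h4, smul_zero]

end Vertical

/-! ### Pseudo-Finsler metrics in an open subset of `E × E` -/

/-- The coordinate expression `ℓ` of a pseudo-Finsler metric, with conic domain `𝒰 ⊆ E × E`. -/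
structure IsLocalFinsler {E : Type*} [NormedAddCommGroup E] [NormedSpace ℝ E]
    (𝒰 : Set (E × E)) (ℓ : E → E → ℝ) : Prop where
  isOpen : IsOpen 𝒰
  smooth : ContDiffOn ℝ ∞ (Function.uncurry ℓ) 𝒰
  homogeneous : ∀ x y, (x, y) ∈ 𝒰 → ∀ c : ℝ, 0 < c → ℓ x (c • y) = c ^ 2 * ℓ x y
  nondegenerate : ∀ x y, (x, y) ∈ 𝒰 → ∀ u, (∀ w, fiberMetric (ℓ x) y u w = 0) → u = 0

section Partial

variable {E : Type*} [NormedAddCommGroup E] [NormedSpace ℝ E]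
  {G : Type*} [NormedAddCommGroup G] [NormedSpace ℝ G]

theorem ContDiffOn.fderiv_snd {f : E → E → G} {𝒰 : Set (E × E)} (ho : IsOpen 𝒰)
    (hf : ContDiffOn ℝ ∞ (Function.uncurry f) 𝒰) :
    ContDiffOn ℝ ∞ (fun q : E × E => fderiv ℝ (f q.1) q.2) 𝒰 := by
  intro q hq
  refine ContDiffAt.contDiffWithinAt ?_
  refine ContDiffAt.fderiv (n := ∞) (f := fun q : E × E => f q.1) (g := Prod.snd) ?_
    contDiffAt_snd (by simp)
  have h : ContDiffAt ℝ ∞ (Function.uncurry f) (q.1, q.2) := hf.contDiffAt (ho.mem_nhds hq)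
  exact h.comp ((q, q.2) : (E × E) × E) (contDiffAt_fst.fst.prodMk contDiffAt_snd)

theorem ContDiffOn.fderiv_fst {f : E → E → G} {𝒰 : Set (E × E)} (ho : IsOpen 𝒰)
    (hf : ContDiffOn ℝ ∞ (Function.uncurry f) 𝒰) :
    ContDiffOn ℝ ∞ (fun q : E × E => fderiv ℝ (fun x => f x q.2) q.1) 𝒰 := by
  intro q hq
  refine ContDiffAt.contDiffWithinAt ?_
  refine ContDiffAt.fderiv (n := ∞) (f := fun (q : E × E) x => f x q.2) (g := Prod.fst) ?_
    contDiffAt_fst (by simp)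
  have h : ContDiffAt ℝ ∞ (Function.uncurry f) (q.1, q.2) := hf.contDiffAt (ho.mem_nhds hq)
  exact h.comp ((q, q.1) : (E × E) × E) (contDiffAt_snd.prodMk contDiffAt_fst.snd)

theorem fderiv_uncurry_apply {f : E → E → G} {x y : E}
    (hf : DifferentiableAt ℝ (Function.uncurry f) (x, y)) (ξ η : E) :
    fderiv ℝ (Function.uncurry f) (x, y) (ξ, η)
      = fderiv ℝ (fun x' => f x' y) x ξ + fderiv ℝ (f x) y η := by
  have h1 : HasFDerivAt (fun x' => f x' y) _ x :=
    HasFDerivAt.comp (g := Function.uncurry f) (f := fun x' => (x', y)) x hf.hasFDerivAt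
      (hasFDerivAt_prodMk_left x y)
  have h2 : HasFDerivAt (f x) _ y :=
    HasFDerivAt.comp (g := Function.uncurry f) (f := fun y' => (x, y')) y hf.hasFDerivAt
      (hasFDerivAt_prodMk_right x y)
  rw [h1.fderiv, h2.fderiv]
  simp [← map_add]

end Partial

namespace IsLocalFinsler

variable {E : Type*} [NormedAddCommGroup E] [NormedSpace ℝ E]
  {𝒰 : Set (E × E)} {ℓ : E → E → ℝ} (h : IsLocalFinsler 𝒰 ℓ)
include h

theorem contDiffAt_snd {x y : E} (hxy : (x, y) ∈ 𝒰) : ContDiffAt ℝ ∞ (ℓ x) y :=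
  (h.smooth.contDiffAt (h.isOpen.mem_nhds hxy)).comp y (contDiffAt_const.prodMk contDiffAt_id)

theorem contDiffOn_fiberMetric :
    ContDiffOn ℝ ∞ (fun q : E × E => fiberMetric (ℓ q.1) q.2) 𝒰 :=
  (ContDiffOn.fderiv_snd h.isOpen
    (f := fun x y => fderiv ℝ (ℓ x) y) (ContDiffOn.fderiv_snd h.isOpen h.smooth)).const_smul
      (1 / 2 : ℝ)

theorem contDiffOn_fiberCartan :
    ContDiffOn ℝ ∞ (fun q : E × E => fiberCartan (ℓ q.1) q.2) 𝒰 :=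
  (ContDiffOn.fderiv_snd h.isOpen (f := fun x y => fderiv ℝ (fderiv ℝ (ℓ x)) y)
    (ContDiffOn.fderiv_snd h.isOpen
    (f := fun x y => fderiv ℝ (ℓ x) y) (ContDiffOn.fderiv_snd h.isOpen h.smooth))).const_smul
      (1 / 4 : ℝ)

theorem contDiffOn_baseDeriv :
    ContDiffOn ℝ ∞ (fun q : E × E => baseDeriv ℓ q.1 q.2) 𝒰 :=
  ContDiffOn.fderiv_fst h.isOpen (f := fun x y => fiberMetric (ℓ x) y) h.contDiffOn_fiberMetric

/-- The factor `2` appears because `g` is half the second differential and `C` a quarter of the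
third, so the vertical derivative of `g` is `2C`. -/
theorem fderiv_fiberMetric {x y : E} (hxy : (x, y) ∈ 𝒰) (ξ η : E) :
    fderiv ℝ (fun q : E × E => fiberMetric (ℓ q.1) q.2) (x, y) (ξ, η)
      = baseDeriv ℓ x y ξ + (2 : ℝ) • fiberCartan (ℓ x) y η := by
  have hd := (h.contDiffOn_fiberMetric.contDiffAt (h.isOpen.mem_nhds hxy)).differentiableAt
    (by simp)
  have e := fderiv_uncurry_apply (f := fun x y => fiberMetric (ℓ x) y) (x := x) (y := y) hd ξ η
  have e2 : fderiv ℝ (fiberMetric (ℓ x)) y = (2 : ℝ) • fiberCartan (ℓ x) y := by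
    have : fiberMetric (ℓ x) = fun y => (1 / 2 : ℝ) • fderiv ℝ (fderiv ℝ (ℓ x)) y := rfl
    rw [this, fderiv_fun_const_smul, fiberCartan, smul_smul]
    · norm_num
    · exact (contDiffAt_fderiv_infty
        (contDiffAt_fderiv_infty (h.contDiffAt_snd hxy))).differentiableAt (by simp)
  refine e.trans ?_
  congr 1
  exact congrArg (fun T => T η) e2

theorem metric_symm {x y : E} (hxy : (x, y) ∈ 𝒰) (u w : E) :
    fiberMetric (ℓ x) y u w = fiberMetric (ℓ x) y w u :=
  fiberMetric_symm (h.contDiffAt_snd hxy) u w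

theorem cartan_self_left {x y : E} (hxy : (x, y) ∈ 𝒰) (u w : E) :
    fiberCartan (ℓ x) y y u w = 0 := by
  have ho : IsOpen {z | (x, z) ∈ 𝒰} := h.isOpen.preimage (by fun_prop)
  rw [fiberCartan_self ho (fun z hz => (h.contDiffAt_snd hz).contDiffWithinAt)
    (fun z hz => h.homogeneous x z hz) hxy]
  simp

theorem cartan_self_mid {x y : E} (hxy : (x, y) ∈ 𝒰) (u w : E) :
    fiberCartan (ℓ x) y u y w = 0 := by
  rw [fiberCartan_symm_left (h.contDiffAt_snd hxy), h.cartan_self_left hxy]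

theorem cartan_self_right {x y : E} (hxy : (x, y) ∈ 𝒰) (u w : E) :
    fiberCartan (ℓ x) y u w y = 0 := by
  rw [fiberCartan_symm_right (h.contDiffAt_snd hxy), h.cartan_self_mid hxy]

theorem baseDeriv_symm {x y : E} (hxy : (x, y) ∈ 𝒰) (X u w : E) :
    baseDeriv ℓ x y X u w = baseDeriv ℓ x y X w u := by
  have hm : ContDiffAt ℝ ∞ (fun q : E × E => fiberMetric (ℓ q.1) q.2) (x, y) :=
    h.contDiffOn_fiberMetric.contDiffAt (h.isOpen.mem_nhds hxy)
  have hd : DifferentiableAt ℝ (fun x' => fiberMetric (ℓ x') y) x :=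
    (hm.comp (g := fun q : E × E => fiberMetric (ℓ q.1) q.2) x
      (contDiffAt_id.prodMk contDiffAt_const)).differentiableAt (by simp)
  have e : (fun x' => fiberMetric (ℓ x') y u w) =ᶠ[𝓝 x] fun x' => fiberMetric (ℓ x') y w u := by
    have : {x' | (x', y) ∈ 𝒰} ∈ 𝓝 x := (h.isOpen.preimage (by fun_prop)).mem_nhds hxy
    filter_upwards [this] with x' hx' using h.metric_symm hx' u w
  rw [baseDeriv, fderiv_apply_apply hd, fderiv_apply_apply hd, e.fderiv_eq]

variable [FiniteDimensional ℝ E]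

/-- The index-lowering isomorphism. -/
theorem exists_flat {x y : E} (hxy : (x, y) ∈ 𝒰) :
    ∃ e : E ≃L[ℝ] (E →L[ℝ] ℝ), (e : E →L[ℝ] E →L[ℝ] ℝ) = fiberMetric (ℓ x) y := by
  have hinj : Function.Injective (fiberMetric (ℓ x) y : E →ₗ[ℝ] E →L[ℝ] ℝ) := by
    rw [injective_iff_map_eq_zero]
    intro u hu
    refine h.nondegenerate x y hxy u fun w => ?_
    exact congrArg (fun T : E →L[ℝ] ℝ => T w) hu
  have hdim : Module.finrank ℝ E = Module.finrank ℝ (E →L[ℝ] ℝ) := by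
    rw [← (LinearMap.toContinuousLinearMap (𝕜 := ℝ) (E := E) (F' := ℝ)).finrank_eq]
    exact (Subspace.dual_finrank_eq (K := ℝ) (V := E)).symm
  refine ⟨(LinearEquiv.ofInjectiveOfFinrankEq _ hinj hdim).toContinuousLinearEquiv, ?_⟩
  ext u w
  rfl

/-- `ContinuousLinearMap.inverse` takes the value zero on non-invertible maps. Nondegeneracy and
finite dimension exclude this on `𝒰`, so `sharp` is a true inverse there. -/
theorem metric_sharp {x y : E} (hxy : (x, y) ∈ 𝒰) (α : E →L[ℝ] ℝ) :
    fiberMetric (ℓ x) y (sharp ℓ x y α) = α := by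
  obtain ⟨e, he⟩ := h.exists_flat hxy
  rw [sharp, ← he, ContinuousLinearMap.inverse_equiv]
  simp

theorem sharp_metric {x y : E} (hxy : (x, y) ∈ 𝒰) (u : E) :
    sharp ℓ x y (fiberMetric (ℓ x) y u) = u := by
  obtain ⟨e, he⟩ := h.exists_flat hxy
  rw [sharp, ← he, ContinuousLinearMap.inverse_equiv]
  simp

theorem metric_injective {x y : E} (hxy : (x, y) ∈ 𝒰) {u u' : E}
    (huv : ∀ w, fiberMetric (ℓ x) y u w = fiberMetric (ℓ x) y u' w) : u = u' := by
  rw [← h.sharp_metric hxy u, ← h.sharp_metric hxy u', ContinuousLinearMap.ext huv]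

theorem contDiffOn_sharp : ContDiffOn ℝ ∞ (fun q : E × E => sharp ℓ q.1 q.2) 𝒰 := by
  intro q hq
  obtain ⟨e, he⟩ := h.exists_flat (x := q.1) (y := q.2) hq
  have : ContDiffAt ℝ ∞ ContinuousLinearMap.inverse (fiberMetric (ℓ q.1) q.2) :=
    he ▸ contDiffAt_map_inverse e
  exact this.comp_contDiffWithinAt q (h.contDiffOn_fiberMetric q hq)

end IsLocalFinsler

/-! ### The Christoffel symbols -/

section Christoffel

variable {E : Type*} [NormedAddCommGroup E] [NormedSpace ℝ E]

/-- Torsion-freeness: exchanging `X` and `Y` swaps the two Cartan terms containing `N X` and `N Y`,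
and the other terms are symmetric by hypothesis. -/
theorem christoffel_comm (ℓ : E → E → ℝ) (x y X Y : E)
    (h1 : ∀ Z, baseDeriv ℓ x y Z X Y = baseDeriv ℓ x y Z Y X)
    (h2 : ∀ Z, fiberCartan (ℓ x) y X Y Z = fiberCartan (ℓ x) y Y X Z) :
    christoffel ℓ x y X Y = christoffel ℓ x y Y X := by
  unfold christoffel
  congr 1
  ext Z
  simp [h1, h2]
  ring

theorem christoffel_add_left (ℓ : E → E → ℝ) (x y X X' Y : E) :
    christoffel ℓ x y (X + X') Y = christoffel ℓ x y X Y + christoffel ℓ x y X' Y := by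
  unfold christoffel
  rw [← map_add]
  congr 1
  ext Z
  simp
  ring

theorem christoffel_add_right (ℓ : E → E → ℝ) (x y X Y Y' : E) :
    christoffel ℓ x y X (Y + Y') = christoffel ℓ x y X Y + christoffel ℓ x y X Y' := by
  unfold christoffel
  rw [← map_add]
  congr 1
  ext Z
  simp
  ring

theorem christoffel_smul_left (ℓ : E → E → ℝ) (x y : E) (c : ℝ) (X Y : E) :
    christoffel ℓ x y (c • X) Y = c • christoffel ℓ x y X Y := by
  unfold christoffel
  rw [← map_smul]
  congr 1
  ext Z
  simp
  ring

theorem christoffel_smul_right (ℓ : E → E → ℝ) (x y : E) (c : ℝ) (X Y : E) :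
    christoffel ℓ x y X (c • Y) = c • christoffel ℓ x y X Y := by
  unfold christoffel
  rw [← map_smul]
  congr 1
  ext Z
  simp
  ring

theorem christoffel_zero_left (ℓ : E → E → ℝ) (x y Y : E) : christoffel ℓ x y 0 Y = 0 := by
  simpa using christoffel_smul_left ℓ x y 0 0 Y

/-- The Christoffel symbols as a continuous bilinear map. -/
noncomputable def christoffelBilin [FiniteDimensional ℝ E] (ℓ : E → E → ℝ) (x y : E) :
    E →L[ℝ] E →L[ℝ] E :=
  (LinearMap.mk₂ ℝ (christoffel ℓ x y) (christoffel_add_left ℓ x y) (christoffel_smul_left ℓ x y)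
    (christoffel_add_right ℓ x y) (christoffel_smul_right ℓ x y)).toContinuousBilinearMap

theorem christoffelBilin_apply [FiniteDimensional ℝ E] (ℓ : E → E → ℝ) (x y X Y : E) :
    christoffelBilin ℓ x y X Y = christoffel ℓ x y X Y := rfl

end Christoffel

/-! ### Smoothness of the Christoffel symbols and almost compatibility -/

namespace IsLocalFinsler

variable {E : Type*} [NormedAddCommGroup E] [NormedSpace ℝ E] [FiniteDimensional ℝ E]
  {𝒰 : Set (E × E)} {ℓ : E → E → ℝ} (h : IsLocalFinsler 𝒰 ℓ)
include h

theorem contDiffOn_chernSpray : ContDiffOn ℝ ∞ (fun q : E × E => chernSpray ℓ q.1 q.2) 𝒰 := by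
  refine h.contDiffOn_sharp.clm_apply (ContDiffOn.sub ?_ (ContDiffOn.const_smul _ ?_))
  · exact (h.contDiffOn_baseDeriv.clm_apply contDiffOn_snd).clm_apply contDiffOn_snd
  · refine contDiffOn_clm_apply.2 fun Z => ?_
    exact ((h.contDiffOn_baseDeriv.clm_apply contDiffOn_const).clm_apply contDiffOn_snd).clm_apply
      contDiffOn_snd

theorem contDiffOn_chernNonlinear :
    ContDiffOn ℝ ∞ (fun q : E × E => chernNonlinear ℓ q.1 q.2) 𝒰 := by
  refine contDiffOn_clm_apply.2 fun X => ?_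
  refine h.contDiffOn_sharp.clm_apply ?_
  refine contDiffOn_clm_apply.2 fun Z => ?_
  have hb := h.contDiffOn_baseDeriv
  have e1 : ContDiffOn ℝ ∞ (fun q : E × E => baseDeriv ℓ q.1 q.2 X q.2 Z) 𝒰 :=
    ((hb.clm_apply contDiffOn_const).clm_apply contDiffOn_snd).clm_apply contDiffOn_const
  have e2 : ContDiffOn ℝ ∞ (fun q : E × E => baseDeriv ℓ q.1 q.2 q.2 X Z) 𝒰 :=
    ((hb.clm_apply contDiffOn_snd).clm_apply contDiffOn_const).clm_apply contDiffOn_const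
  have e3 : ContDiffOn ℝ ∞ (fun q : E × E => baseDeriv ℓ q.1 q.2 Z q.2 X) 𝒰 :=
    ((hb.clm_apply contDiffOn_const).clm_apply contDiffOn_snd).clm_apply contDiffOn_const
  have e4 : ContDiffOn ℝ ∞
      (fun q : E × E => fiberCartan (ℓ q.1) q.2 (chernSpray ℓ q.1 q.2) X Z) 𝒰 :=
    ((h.contDiffOn_fiberCartan.clm_apply h.contDiffOn_chernSpray).clm_apply
      contDiffOn_const).clm_apply contDiffOn_const
  exact (((e1.add e2).sub e3).const_smul (1 / 2 : ℝ)).sub e4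

theorem contDiffOn_christoffelBilin :
    ContDiffOn ℝ ∞ (fun q : E × E => christoffelBilin ℓ q.1 q.2) 𝒰 := by
  refine contDiffOn_clm_apply.2 fun X => contDiffOn_clm_apply.2 fun Y => ?_
  refine h.contDiffOn_sharp.clm_apply ?_
  refine contDiffOn_clm_apply.2 fun Z => ?_
  have hb : ∀ u v w, ContDiffOn ℝ ∞ (fun q : E × E => baseDeriv ℓ q.1 q.2 u v w) 𝒰 :=
    fun u v w => ((h.contDiffOn_baseDeriv.clm_apply contDiffOn_const).clm_apply
      contDiffOn_const).clm_apply contDiffOn_const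
  have hN : ∀ u, ContDiffOn ℝ ∞ (fun q : E × E => chernNonlinear ℓ q.1 q.2 u) 𝒰 :=
    fun u => h.contDiffOn_chernNonlinear.clm_apply contDiffOn_const
  have hC : ∀ u v w, ContDiffOn ℝ ∞
      (fun q : E × E => fiberCartan (ℓ q.1) q.2 (chernNonlinear ℓ q.1 q.2 u) v w) 𝒰 :=
    fun u v w => ((h.contDiffOn_fiberCartan.clm_apply (hN u)).clm_apply
      contDiffOn_const).clm_apply contDiffOn_const
  have hC' : ContDiffOn ℝ ∞
      (fun q : E × E => fiberCartan (ℓ q.1) q.2 X Y (chernNonlinear ℓ q.1 q.2 Z)) 𝒰 :=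
    ((h.contDiffOn_fiberCartan.clm_apply contDiffOn_const).clm_apply
      contDiffOn_const).clm_apply (hN Z)
  exact ((((((hb X Y Z).add (hb Y X Z)).sub (hb Z X Y)).const_smul (1 / 2 : ℝ)).sub
    (hC X Y Z)).sub (hC Y X Z)).add hC'

variable {x y : E} (hxy : (x, y) ∈ 𝒰)
include hxy

theorem christoffelBilin_comm (X Y : E) :
    christoffelBilin ℓ x y X Y = christoffelBilin ℓ x y Y X :=
  christoffel_comm ℓ x y X Y (fun Z => h.baseDeriv_symm hxy Z X Y)
    (fun Z => fiberCartan_symm_left (h.contDiffAt_snd hxy) X Y Z)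

theorem metric_christoffel (X Y Z : E) :
    fiberMetric (ℓ x) y (christoffelBilin ℓ x y X Y) Z
      = (1 / 2 : ℝ) * (baseDeriv ℓ x y X Y Z + baseDeriv ℓ x y Y X Z - baseDeriv ℓ x y Z X Y)
        - fiberCartan (ℓ x) y (chernNonlinear ℓ x y X) Y Z
        - fiberCartan (ℓ x) y (chernNonlinear ℓ x y Y) X Z
        + fiberCartan (ℓ x) y X Y (chernNonlinear ℓ x y Z) := by
  rw [christoffelBilin_apply, christoffel, h.metric_sharp hxy]
  simp

theorem metric_chernNonlinear (X Z : E) :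
    fiberMetric (ℓ x) y (chernNonlinear ℓ x y X) Z
      = (1 / 2 : ℝ) * (baseDeriv ℓ x y X y Z + baseDeriv ℓ x y y X Z - baseDeriv ℓ x y Z y X)
        - fiberCartan (ℓ x) y (chernSpray ℓ x y) X Z := by
  rw [chernNonlinear, ContinuousLinearMap.comp_apply, h.metric_sharp hxy]
  simp

theorem metric_chernSpray (Z : E) :
    fiberMetric (ℓ x) y (chernSpray ℓ x y) Z
      = baseDeriv ℓ x y y y Z - (1 / 2 : ℝ) * baseDeriv ℓ x y Z y y := by
  rw [chernSpray, h.metric_sharp hxy]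
  simp

/-- For `X = y` the Cartan term has `y` among its arguments and vanishes, and two of the three base
derivatives coincide. -/
theorem chernNonlinear_self : chernNonlinear ℓ x y y = chernSpray ℓ x y := by
  refine h.metric_injective hxy fun Z => ?_
  rw [h.metric_chernNonlinear hxy, h.metric_chernSpray hxy, h.cartan_self_mid hxy]
  ring

/-- This closes the staged definition: the map `N` inserted in the Koszul-type formula is indeed
`Γ(·, y)`. With `Y = y`, only the Cartan term containing `N y` survives, and `N y` is the spray
vector. -/
theorem christoffelBilin_self_right (X : E) :
    christoffelBilin ℓ x y X y = chernNonlinear ℓ x y X := by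
  refine h.metric_injective hxy fun Z => ?_
  rw [h.metric_christoffel hxy, h.metric_chernNonlinear hxy, h.chernNonlinear_self hxy,
    h.cartan_self_mid hxy, h.cartan_self_mid hxy, h.baseDeriv_symm hxy Z X y]
  ring

/-- Almost `g`-compatibility of the Chern connection in coordinates. -/
theorem baseDeriv_eq (X Y Z : E) :
    baseDeriv ℓ x y X Y Z
      = fiberMetric (ℓ x) y (christoffelBilin ℓ x y Y X) Z
        + fiberMetric (ℓ x) y Y (christoffelBilin ℓ x y Z X)
        + 2 * fiberCartan (ℓ x) y (christoffelBilin ℓ x y y X) Y Z := by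
  have hs := h.contDiffAt_snd hxy
  -- Add the Koszul-type formulas for `g(Γ(Y,X), Z)` and `g(Γ(Z,X), Y)`. The base derivatives
  -- collapse to `(∂_X g)(Y,Z)`, the terms with `N Y` and `N Z` cancel by symmetry of the Cartan
  -- tensor, and the remaining `-2 C(N X, Y, Z)` is removed by the correction term.
  rw [h.metric_symm hxy Y, h.christoffelBilin_comm hxy y X, h.christoffelBilin_self_right hxy,
    h.metric_christoffel hxy, h.metric_christoffel hxy, h.baseDeriv_symm hxy X Z Y,
    h.baseDeriv_symm hxy Z Y X, h.baseDeriv_symm hxy Y Z X,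
    fiberCartan_symm_right hs (chernNonlinear ℓ x y X) Z Y,
    fiberCartan_symm_right hs Y X, fiberCartan_symm_left hs Y _ X,
    fiberCartan_symm_right hs Z X, fiberCartan_symm_left hs Z _ X,
    fiberCartan_symm_right hs (chernNonlinear ℓ x y Y) Z X,
    fiberCartan_symm_right hs (chernNonlinear ℓ x y Z) Y X]
  ring

end IsLocalFinsler

/-! ### Calculus on two-parameter domains -/

/-- A domain of parameters `(t, s)`, relatively open in the product of the parameter
intervals `J` and `K`. -/
structure IsPatch (J K : Set ℝ) (T : Set (ℝ × ℝ)) : Prop where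
  subset : T ⊆ J ×ˢ K
  uniqueDiffOn_left : UniqueDiffOn ℝ J
  uniqueDiffOn_right : UniqueDiffOn ℝ K
  uniqueDiffOn : UniqueDiffOn ℝ T
  subset_closure : T ⊆ closure (interior T)
  slice_left : ∀ t s, (t, s) ∈ T → {τ | (τ, s) ∈ T} ∈ 𝓝[J] t
  slice_right : ∀ t s, (t, s) ∈ T → {σ | (t, σ) ∈ T} ∈ 𝓝[K] s

/-- In the application `O` cuts out the parameters that are mapped into one chart. The points with
`t = a` or `t = b` may be boundary points of the patch, where derivatives are one-sided. Symmetry of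
second derivatives still holds there because, as `a < b`, they are limits of interior points. -/
theorem isPatch_inter {a b ε : ℝ} (hab : a < b) {O : Set (ℝ × ℝ)} (hO : IsOpen O) :
    IsPatch (Icc a b) (Ioo (-ε) ε) ((Icc a b ×ˢ Ioo (-ε) ε) ∩ O) where
  subset := inter_subset_left
  uniqueDiffOn_left := uniqueDiffOn_Icc hab
  uniqueDiffOn_right := isOpen_Ioo.uniqueDiffOn
  uniqueDiffOn := ((uniqueDiffOn_Icc hab).prod isOpen_Ioo.uniqueDiffOn).inter hO
  subset_closure := by
    rw [interior_inter, hO.interior_eq, interior_prod_eq, interior_Icc, interior_Ioo]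
    have h1 : Icc a b ×ˢ Ioo (-ε) ε ⊆ closure (Ioo a b ×ˢ Ioo (-ε) ε) := by
      rw [closure_prod_eq, closure_Ioo hab.ne]
      exact prod_mono_right subset_closure
    exact (inter_subset_inter_left O h1).trans hO.closure_inter
  slice_left t s hts := by
    have : {τ | (τ, s) ∈ O} ∈ 𝓝 t := (hO.preimage (by fun_prop)).mem_nhds hts.2
    filter_upwards [mem_nhdsWithin_of_mem_nhds this, self_mem_nhdsWithin] with τ h1 h2
    exact ⟨⟨h2, hts.1.2⟩, h1⟩
  slice_right t s hts := by
    have : {σ | (t, σ) ∈ O} ∈ 𝓝 s := (hO.preimage (by fun_prop)).mem_nhds hts.2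
    filter_upwards [mem_nhdsWithin_of_mem_nhds this, self_mem_nhdsWithin] with τ h1 h2
    exact ⟨⟨hts.1.1, h2⟩, h1⟩

section TwoParameter

variable {G : Type*} [NormedAddCommGroup G] [NormedSpace ℝ G]

/-- Partial derivative in the first parameter, relative to `J`. -/
noncomputable def pderivLeft (J : Set ℝ) (f : ℝ → ℝ → G) (t s : ℝ) : G :=
  derivWithin (fun τ => f τ s) J t

/-- Partial derivative in the second parameter, relative to `K`. -/
noncomputable def pderivRight (K : Set ℝ) (f : ℝ → ℝ → G) (t s : ℝ) : G :=
  derivWithin (fun σ => f t σ) K s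

namespace IsPatch

variable {J K : Set ℝ} {T : Set (ℝ × ℝ)} (hT : IsPatch J K T)
include hT

/-- The chain rule gives a derivative within the slice of `T`. This slice is a neighbourhood of `t`
within `J`, so it is also a derivative within `J`. -/
theorem hasDerivWithinAt_left_aux {f : ℝ → ℝ → G} (hf : ContDiffOn ℝ ∞ (Function.uncurry f) T)
    {t s : ℝ} (hts : (t, s) ∈ T) :
    HasDerivWithinAt (fun τ => f τ s) (fderivWithin ℝ (Function.uncurry f) T (t, s) (1, 0)) J t := by
  have h1 := ((hf.differentiableOn (by simp)) (t, s) hts).hasFDerivWithinAt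
  have h2 : HasDerivWithinAt (fun τ : ℝ => (τ, s)) ((1 : ℝ), (0 : ℝ)) {τ | (τ, s) ∈ T} t :=
    ((hasDerivAt_id t).prodMk (hasDerivAt_const t s)).hasDerivWithinAt
  exact (HasFDerivWithinAt.comp_hasDerivWithinAt (l := Function.uncurry f)
    (f := fun τ : ℝ => (τ, s)) t h1 h2
    (fun τ hτ => hτ)).mono_of_mem_nhdsWithin (hT.slice_left t s hts)

theorem hasDerivWithinAt_right_aux {f : ℝ → ℝ → G} (hf : ContDiffOn ℝ ∞ (Function.uncurry f) T)
    {t s : ℝ} (hts : (t, s) ∈ T) :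
    HasDerivWithinAt (fun σ => f t σ) (fderivWithin ℝ (Function.uncurry f) T (t, s) (0, 1)) K s := by
  have h1 := ((hf.differentiableOn (by simp)) (t, s) hts).hasFDerivWithinAt
  have h2 : HasDerivWithinAt (fun σ : ℝ => (t, σ)) ((0 : ℝ), (1 : ℝ)) {σ | (t, σ) ∈ T} s :=
    ((hasDerivAt_const s t).prodMk (hasDerivAt_id s)).hasDerivWithinAt
  exact (HasFDerivWithinAt.comp_hasDerivWithinAt (l := Function.uncurry f)
    (f := fun σ : ℝ => (t, σ)) s h1 h2
    (fun σ hσ => hσ)).mono_of_mem_nhdsWithin (hT.slice_right t s hts)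

theorem pderivLeft_eq {f : ℝ → ℝ → G} (hf : ContDiffOn ℝ ∞ (Function.uncurry f) T)
    {t s : ℝ} (hts : (t, s) ∈ T) :
    pderivLeft J f t s = fderivWithin ℝ (Function.uncurry f) T (t, s) (1, 0) :=
  (hT.hasDerivWithinAt_left_aux hf hts).derivWithin (hT.uniqueDiffOn_left t (hT.subset hts).1)

theorem pderivRight_eq {f : ℝ → ℝ → G} (hf : ContDiffOn ℝ ∞ (Function.uncurry f) T)
    {t s : ℝ} (hts : (t, s) ∈ T) :
    pderivRight K f t s = fderivWithin ℝ (Function.uncurry f) T (t, s) (0, 1) :=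
  (hT.hasDerivWithinAt_right_aux hf hts).derivWithin (hT.uniqueDiffOn_right s (hT.subset hts).2)

theorem hasDerivWithinAt_left {f : ℝ → ℝ → G} (hf : ContDiffOn ℝ ∞ (Function.uncurry f) T)
    {t s : ℝ} (hts : (t, s) ∈ T) :
    HasDerivWithinAt (fun τ => f τ s) (pderivLeft J f t s) J t :=
  hT.pderivLeft_eq hf hts ▸ hT.hasDerivWithinAt_left_aux hf hts

theorem hasDerivWithinAt_right {f : ℝ → ℝ → G} (hf : ContDiffOn ℝ ∞ (Function.uncurry f) T)
    {t s : ℝ} (hts : (t, s) ∈ T) :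
    HasDerivWithinAt (fun σ => f t σ) (pderivRight K f t s) K s :=
  hT.pderivRight_eq hf hts ▸ hT.hasDerivWithinAt_right_aux hf hts

theorem contDiffOn_pderivLeft {f : ℝ → ℝ → G} (hf : ContDiffOn ℝ ∞ (Function.uncurry f) T) :
    ContDiffOn ℝ ∞ (Function.uncurry (pderivLeft J f)) T :=
  ((hf.fderivWithin (m := ∞) hT.uniqueDiffOn (by simp)).clm_apply contDiffOn_const).congr
    fun q hq => hT.pderivLeft_eq hf (t := q.1) (s := q.2) hq

theorem contDiffOn_pderivRight {f : ℝ → ℝ → G} (hf : ContDiffOn ℝ ∞ (Function.uncurry f) T) :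
    ContDiffOn ℝ ∞ (Function.uncurry (pderivRight K f)) T :=
  ((hf.fderivWithin (m := ∞) hT.uniqueDiffOn (by simp)).clm_apply contDiffOn_const).congr
    fun q hq => hT.pderivRight_eq hf (t := q.1) (s := q.2) hq

theorem pderivLeft_congr {f g : ℝ → ℝ → G} (hfg : ∀ t s, (t, s) ∈ T → f t s = g t s)
    {t s : ℝ} (hts : (t, s) ∈ T) : pderivLeft J f t s = pderivLeft J g t s := by
  refine Filter.EventuallyEq.derivWithin_eq ?_ (hfg t s hts)
  filter_upwards [hT.slice_left t s hts] with τ hτ using hfg τ s hτ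

theorem pderivRight_congr {f g : ℝ → ℝ → G} (hfg : ∀ t s, (t, s) ∈ T → f t s = g t s)
    {t s : ℝ} (hts : (t, s) ∈ T) : pderivRight K f t s = pderivRight K g t s := by
  refine Filter.EventuallyEq.derivWithin_eq ?_ (hfg t s hts)
  filter_upwards [hT.slice_right t s hts] with τ hτ using hfg t τ hτ

/-- Schwarz's theorem up to the boundary: both mixed partials are values of the second derivative
within `T`, which is symmetric because `T` has unique derivatives and lies in the closure of its
interior. -/
theorem pderiv_comm {f : ℝ → ℝ → G} (hf : ContDiffOn ℝ ∞ (Function.uncurry f) T)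
    {t s : ℝ} (hts : (t, s) ∈ T) :
    pderivLeft J (pderivRight K f) t s = pderivRight K (pderivLeft J f) t s := by
  have hu := hT.uniqueDiffOn (t, s) hts
  have hD := ((hf.fderivWithin (m := ∞) hT.uniqueDiffOn (by simp)).differentiableOn (by simp))
    (t, s) hts
  have key : ∀ v : ℝ × ℝ, fderivWithin ℝ (fun q => fderivWithin ℝ (Function.uncurry f) T q v) T (t, s)
      = (fderivWithin ℝ (fderivWithin ℝ (Function.uncurry f) T) T (t, s)).flip v := by
    intro v
    rw [(hD.hasFDerivWithinAt.clm_apply (hasFDerivWithinAt_const v (t, s) T)).fderivWithin hu]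
    ext <;> simp
  have e1 : fderivWithin ℝ (Function.uncurry (pderivRight K f)) T (t, s)
      = fderivWithin ℝ (fun q => fderivWithin ℝ (Function.uncurry f) T q (0, 1)) T (t, s) :=
    fderivWithin_congr (fun q hq => hT.pderivRight_eq hf (t := q.1) (s := q.2) hq)
      (hT.pderivRight_eq hf hts)
  have e2 : fderivWithin ℝ (Function.uncurry (pderivLeft J f)) T (t, s)
      = fderivWithin ℝ (fun q => fderivWithin ℝ (Function.uncurry f) T q (1, 0)) T (t, s) :=
    fderivWithin_congr (fun q hq => hT.pderivLeft_eq hf (t := q.1) (s := q.2) hq)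
      (hT.pderivLeft_eq hf hts)
  rw [hT.pderivLeft_eq (hT.contDiffOn_pderivRight hf) hts,
    hT.pderivRight_eq (hT.contDiffOn_pderivLeft hf) hts, e1, e2, key, key]
  have hsym := (hf (t, s) hts).isSymmSndFDerivWithinAt
    (by simpa using ofNat_le_infty 2) hT.uniqueDiffOn (hT.subset_closure hts) hts
  exact hsym.eq (1, 0) (0, 1)

end IsPatch

end TwoParameter

/-! ### Covariant derivatives along curves and two-parameter maps, in coordinates -/

/-- The curvature of a variation in coordinates: `x`, `w` are the base point and the reference
vector, `x₁, w₁` their longitudinal derivatives, `x₂, w₂` their transverse derivatives. -/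
noncomputable def curvCoord {E : Type*} [NormedAddCommGroup E] [NormedSpace ℝ E]
    [FiniteDimensional ℝ E] (ℓ : E → E → ℝ) (x w x₁ w₁ x₂ w₂ z : E) : E :=
  fderiv ℝ (fun q : E × E => christoffelBilin ℓ q.1 q.2) (x, w) (x₁, w₁) z x₂
    - fderiv ℝ (fun q : E × E => christoffelBilin ℓ q.1 q.2) (x, w) (x₂, w₂) z x₁
    + christoffelBilin ℓ x w (christoffelBilin ℓ x w z x₂) x₁
    - christoffelBilin ℓ x w (christoffelBilin ℓ x w z x₁) x₂

namespace IsLocalFinsler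

variable {E : Type*} [NormedAddCommGroup E] [NormedSpace ℝ E] [FiniteDimensional ℝ E]
  {𝒰 : Set (E × E)} {ℓ : E → E → ℝ} (h : IsLocalFinsler 𝒰 ℓ)
include h

/-- Almost compatibility of the covariant derivative along a curve with the fundamental tensor. -/
theorem hasDerivWithinAt_metric {J : Set ℝ} {x w z₁ z₂ : ℝ → E} {t : ℝ}
    (hxw : (x t, w t) ∈ 𝒰) (hx : DifferentiableWithinAt ℝ x J t)
    (hw : DifferentiableWithinAt ℝ w J t) (h₁ : DifferentiableWithinAt ℝ z₁ J t)
    (h₂ : DifferentiableWithinAt ℝ z₂ J t) :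
    HasDerivWithinAt (fun τ => fiberMetric (ℓ (x τ)) (w τ) (z₁ τ) (z₂ τ))
      (fiberMetric (ℓ (x t)) (w t) (covDerivCoord ℓ J x w z₁ t) (z₂ t)
        + fiberMetric (ℓ (x t)) (w t) (z₁ t) (covDerivCoord ℓ J x w z₂ t)
        + 2 * fiberCartan (ℓ (x t)) (w t) (covDerivCoord ℓ J x w w t) (z₁ t) (z₂ t)) J t := by
  have hm := ((h.contDiffOn_fiberMetric.contDiffAt (h.isOpen.mem_nhds hxw)).differentiableAt
    (by simp)).hasFDerivAt
  have hc := HasFDerivAt.comp_hasDerivWithinAt (l := fun q : E × E => fiberMetric (ℓ q.1) q.2)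
    (f := fun τ => (x τ, w τ)) t hm (hx.hasDerivWithinAt.prodMk hw.hasDerivWithinAt)
  rw [h.fderiv_fiberMetric hxw] at hc
  refine ((hc.clm_apply h₁.hasDerivWithinAt).clm_apply h₂.hasDerivWithinAt).congr_deriv ?_
  -- By almost compatibility the base derivative of `g` supplies the Christoffel parts of the
  -- derivatives of `z₁` and `z₂`. Its term `2 C(Γ(w, x'), ·, ·)` joins the vertical derivative `2
  -- C(w', ·, ·)` to form `2 C(D w, ·, ·)`.
  simp only [covDerivCoord, ← christoffelBilin_apply, Function.comp_apply, map_add, add_apply,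
    smul_apply, smul_eq_mul, h.baseDeriv_eq hxw]
  ring

theorem hasDerivWithinAt_christoffel {J : Set ℝ} {x w z u : ℝ → E} {t : ℝ} {x' w' z' u' : E}
    (hxw : (x t, w t) ∈ 𝒰) (hx : HasDerivWithinAt x x' J t)
    (hw : HasDerivWithinAt w w' J t) (hz : HasDerivWithinAt z z' J t)
    (hu : HasDerivWithinAt u u' J t) :
    HasDerivWithinAt (fun τ => christoffel ℓ (x τ) (w τ) (z τ) (u τ))
      (fderiv ℝ (fun q : E × E => christoffelBilin ℓ q.1 q.2) (x t, w t) (x', w') (z t) (u t)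
        + christoffelBilin ℓ (x t) (w t) z' (u t) + christoffelBilin ℓ (x t) (w t) (z t) u')
      J t := by
  have hm := ((h.contDiffOn_christoffelBilin.contDiffAt (h.isOpen.mem_nhds hxw)).differentiableAt
    (by simp)).hasFDerivAt
  have hc := HasFDerivAt.comp_hasDerivWithinAt
    (l := fun q : E × E => christoffelBilin ℓ q.1 q.2)
    (f := fun τ => (x τ, w τ)) t hm (hx.prodMk hw)
  refine ((hc.clm_apply hz).clm_apply hu).congr_deriv ?_
  simp

variable {J K : Set ℝ} {T : Set (ℝ × ℝ)} (hT : IsPatch J K T) {x w z : ℝ → ℝ → E}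
  (hx : ContDiffOn ℝ ∞ (Function.uncurry x) T) (hw : ContDiffOn ℝ ∞ (Function.uncurry w) T)
  (hz : ContDiffOn ℝ ∞ (Function.uncurry z) T) (hxw : ∀ t s, (t, s) ∈ T → (x t s, w t s) ∈ 𝒰)
include hT hx hw hz hxw

theorem contDiffOn_covDeriv_left :
    ContDiffOn ℝ ∞ (Function.uncurry fun t s => covDerivCoord ℓ J (fun τ => x τ s)
      (fun τ => w τ s) (fun τ => z τ s) t) T := by
  have hΓ : ContDiffOn ℝ ∞ (fun q : ℝ × ℝ => christoffelBilin ℓ (x q.1 q.2) (w q.1 q.2)) T :=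
    h.contDiffOn_christoffelBilin.comp (f := fun q : ℝ × ℝ => (x q.1 q.2, w q.1 q.2))
      (hx.prodMk hw) fun q hq => hxw q.1 q.2 hq
  have h1 : ContDiffOn ℝ ∞ (fun q : ℝ × ℝ => pderivLeft J z q.1 q.2) T :=
    hT.contDiffOn_pderivLeft hz
  have h2 : ContDiffOn ℝ ∞ (fun q : ℝ × ℝ => christoffelBilin ℓ (x q.1 q.2) (w q.1 q.2)
      (z q.1 q.2) (pderivLeft J x q.1 q.2)) T :=
    (hΓ.clm_apply hz).clm_apply (hT.contDiffOn_pderivLeft hx)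
  exact (h1.add h2).congr fun q hq => rfl

theorem contDiffOn_covDeriv_right :
    ContDiffOn ℝ ∞ (Function.uncurry fun t s => covDerivCoord ℓ K (x t) (w t) (z t) s) T := by
  have hΓ : ContDiffOn ℝ ∞ (fun q : ℝ × ℝ => christoffelBilin ℓ (x q.1 q.2) (w q.1 q.2)) T :=
    h.contDiffOn_christoffelBilin.comp (f := fun q : ℝ × ℝ => (x q.1 q.2, w q.1 q.2))
      (hx.prodMk hw) fun q hq => hxw q.1 q.2 hq
  have h1 : ContDiffOn ℝ ∞ (fun q : ℝ × ℝ => pderivRight K z q.1 q.2) T :=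
    hT.contDiffOn_pderivRight hz
  have h2 : ContDiffOn ℝ ∞ (fun q : ℝ × ℝ => christoffelBilin ℓ (x q.1 q.2) (w q.1 q.2)
      (z q.1 q.2) (pderivRight K x q.1 q.2)) T :=
    (hΓ.clm_apply hz).clm_apply (hT.contDiffOn_pderivRight hx)
  exact (h1.add h2).congr fun q hq => rfl

/-- The commutator of the covariant derivatives depends on the first derivatives of the base point
and of the reference vector only. -/
theorem covDeriv_commutator {t s : ℝ} (hts : (t, s) ∈ T) :
    covDerivCoord ℓ J (fun τ => x τ s) (fun τ => w τ s)
        (fun τ => covDerivCoord ℓ K (x τ) (w τ) (z τ) s) t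
      - covDerivCoord ℓ K (x t) (w t)
        (fun σ => covDerivCoord ℓ J (fun τ => x τ σ) (fun τ => w τ σ) (fun τ => z τ σ) t) s
      = curvCoord ℓ (x t s) (w t s) (pderivLeft J x t s) (pderivLeft J w t s)
          (pderivRight K x t s) (pderivRight K w t s) (z t s) := by
  have hJ := hT.uniqueDiffOn_left t (hT.subset hts).1
  have hK := hT.uniqueDiffOn_right s (hT.subset hts).2
  have e1 := ((hT.hasDerivWithinAt_left (hT.contDiffOn_pderivRight hz) hts).add
    (h.hasDerivWithinAt_christoffel (x := fun τ => x τ s) (hxw t s hts)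
      (hT.hasDerivWithinAt_left hx hts)
      (hT.hasDerivWithinAt_left hw hts) (hT.hasDerivWithinAt_left hz hts)
      (hT.hasDerivWithinAt_left (hT.contDiffOn_pderivRight hx) hts))).derivWithin hJ
  have e2 := ((hT.hasDerivWithinAt_right (hT.contDiffOn_pderivLeft hz) hts).add
    (h.hasDerivWithinAt_christoffel (x := x t) (hxw t s hts)
      (hT.hasDerivWithinAt_right hx hts)
      (hT.hasDerivWithinAt_right hw hts) (hT.hasDerivWithinAt_right hz hts)
      (hT.hasDerivWithinAt_right (hT.contDiffOn_pderivLeft hx) hts))).derivWithin hK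
  have e1' : derivWithin (fun τ => covDerivCoord ℓ K (x τ) (w τ) (z τ) s) J t = _ := e1
  have e2' : derivWithin (fun σ => covDerivCoord ℓ J (fun τ => x τ σ) (fun τ => w τ σ)
    (fun τ => z τ σ) t) K s = _ := e2
  have f1 : covDerivCoord ℓ J (fun τ => x τ s) (fun τ => w τ s)
        (fun τ => covDerivCoord ℓ K (x τ) (w τ) (z τ) s) t
      = derivWithin (fun τ => covDerivCoord ℓ K (x τ) (w τ) (z τ) s) J t
        + christoffelBilin ℓ (x t s) (w t s) (pderivRight K z t s
          + christoffelBilin ℓ (x t s) (w t s) (z t s) (pderivRight K x t s))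
          (pderivLeft J x t s) := rfl
  have f2 : covDerivCoord ℓ K (x t) (w t)
        (fun σ => covDerivCoord ℓ J (fun τ => x τ σ) (fun τ => w τ σ) (fun τ => z τ σ) t) s
      = derivWithin (fun σ => covDerivCoord ℓ J (fun τ => x τ σ) (fun τ => w τ σ)
          (fun τ => z τ σ) t) K s
        + christoffelBilin ℓ (x t s) (w t s) (pderivLeft J z t s
          + christoffelBilin ℓ (x t s) (w t s) (z t s) (pderivLeft J x t s))
          (pderivRight K x t s) := rfl
  -- Once the mixed partials of `z` and `x` are identified, all second derivatives cancel, and so do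
  -- the terms linear in first derivatives of `z`.
  rw [f1, f2, e1', e2', hT.pderiv_comm hz hts, hT.pderiv_comm hx hts]
  simp only [map_add, add_apply, curvCoord]
  abel

/-- Skew-symmetry of the commutator of the covariant derivatives, when one of the arguments is the
reference vector. -/
theorem metric_commutator {t s : ℝ} (hts : (t, s) ∈ T) :
    fiberMetric (ℓ (x t s)) (w t s) (curvCoord ℓ (x t s) (w t s) (pderivLeft J x t s)
        (pderivLeft J w t s) (pderivRight K x t s) (pderivRight K w t s) (w t s)) (z t s)
      = - fiberMetric (ℓ (x t s)) (w t s) (curvCoord ℓ (x t s) (w t s) (pderivLeft J x t s)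
        (pderivLeft J w t s) (pderivRight K x t s) (pderivRight K w t s) (z t s)) (w t s) := by
  have hJ := hT.uniqueDiffOn_left t (hT.subset hts).1
  have hK := hT.uniqueDiffOn_right s (hT.subset hts).2
  let Dl : (ℝ → ℝ → E) → ℝ → ℝ → E := fun ζ t' s' =>
    covDerivCoord ℓ J (fun τ => x τ s') (fun τ => w τ s') (fun τ => ζ τ s') t'
  let Dr : (ℝ → ℝ → E) → ℝ → ℝ → E := fun ζ t' s' => covDerivCoord ℓ K (x t') (w t') (ζ t') s'
  let g : (ℝ → ℝ → E) → (ℝ → ℝ → E) → ℝ → ℝ → ℝ := fun ζ ξ t' s' =>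
    fiberMetric (ℓ (x t' s')) (w t' s') (ζ t' s') (ξ t' s')
  have sDl : ∀ ζ, ContDiffOn ℝ ∞ (Function.uncurry ζ) T →
      ContDiffOn ℝ ∞ (Function.uncurry (Dl ζ)) T :=
    fun ζ hζ => h.contDiffOn_covDeriv_left hT hx hw hζ hxw
  have sDr : ∀ ζ, ContDiffOn ℝ ∞ (Function.uncurry ζ) T →
      ContDiffOn ℝ ∞ (Function.uncurry (Dr ζ)) T :=
    fun ζ hζ => h.contDiffOn_covDeriv_right hT hx hw hζ hxw
  have sg : ContDiffOn ℝ ∞ (Function.uncurry (g w z)) T :=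
    ((h.contDiffOn_fiberMetric.comp (hx.prodMk hw) fun q hq => hxw q.1 q.2 hq).clm_apply
      hw).clm_apply hz
  have gl : ∀ ζ ξ, ContDiffOn ℝ ∞ (Function.uncurry ζ) T → ContDiffOn ℝ ∞ (Function.uncurry ξ) T →
      ∀ t s, (t, s) ∈ T → HasDerivWithinAt (fun τ => g ζ ξ τ s) (g (Dl ζ) ξ t s + g ζ (Dl ξ) t s
        + 2 * fiberCartan (ℓ (x t s)) (w t s) (Dl w t s) (ζ t s) (ξ t s)) J t :=
    fun ζ ξ hζ hξ t s hts => h.hasDerivWithinAt_metric (x := fun τ => x τ s) (hxw t s hts)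
      (hT.hasDerivWithinAt_left hx hts).differentiableWithinAt
      (hT.hasDerivWithinAt_left hw hts).differentiableWithinAt
      (hT.hasDerivWithinAt_left hζ hts).differentiableWithinAt
      (hT.hasDerivWithinAt_left hξ hts).differentiableWithinAt
  have gr : ∀ ζ ξ, ContDiffOn ℝ ∞ (Function.uncurry ζ) T → ContDiffOn ℝ ∞ (Function.uncurry ξ) T →
      ∀ t s, (t, s) ∈ T → HasDerivWithinAt (fun σ => g ζ ξ t σ) (g (Dr ζ) ξ t s + g ζ (Dr ξ) t s
        + 2 * fiberCartan (ℓ (x t s)) (w t s) (Dr w t s) (ζ t s) (ξ t s)) K s :=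
    fun ζ ξ hζ hξ t s hts => h.hasDerivWithinAt_metric (x := x t) (hxw t s hts)
      (hT.hasDerivWithinAt_right hx hts).differentiableWithinAt
      (hT.hasDerivWithinAt_right hw hts).differentiableWithinAt
      (hT.hasDerivWithinAt_right hζ hts).differentiableWithinAt
      (hT.hasDerivWithinAt_right hξ hts).differentiableWithinAt
  -- No Cartan correction appears here, as one of its arguments is the reference vector `w`.
  have el : ∀ t s, (t, s) ∈ T → pderivLeft J (g w z) t s = g (Dl w) z t s + g w (Dl z) t s := by
    intro t s hts
    have := (gl w z hw hz t s hts).derivWithin (hT.uniqueDiffOn_left t (hT.subset hts).1)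
    rwa [h.cartan_self_mid (hxw t s hts), mul_zero, add_zero] at this
  have er : ∀ t s, (t, s) ∈ T → pderivRight K (g w z) t s = g (Dr w) z t s + g w (Dr z) t s := by
    intro t s hts
    have := (gr w z hw hz t s hts).derivWithin (hT.uniqueDiffOn_right s (hT.subset hts).2)
    rwa [h.cartan_self_mid (hxw t s hts), mul_zero, add_zero] at this
  have elr : pderivLeft J (pderivRight K (g w z)) t s = _ :=
    (hT.pderivLeft_congr er hts).trans
      (((gl (Dr w) z (sDr w hw) hz t s hts).add (gl w (Dr z) hw (sDr z hz) t s hts)).derivWithin hJ)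
  have erl : pderivRight K (pderivLeft J (g w z)) t s = _ :=
    (hT.pderivRight_congr el hts).trans
      (((gr (Dl w) z (sDl w hw) hz t s hts).add (gr w (Dl z) hw (sDl z hz) t s hts)).derivWithin hK)
  have key := (elr.symm.trans (hT.pderiv_comm sg hts)).trans erl
  -- Of the four Cartan corrections in the mixed partials, two contain `w` as an argument and
  -- vanish; the other two become equal after exchanging `Dl w` and `Dr w`.
  rw [h.cartan_self_mid (hxw t s hts), h.cartan_self_mid (hxw t s hts),
    fiberCartan_symm_left (h.contDiffAt_snd (hxw t s hts)) (Dl w t s)] at key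
  have cw := h.covDeriv_commutator hT hx hw hw hxw hts
  have cz := h.covDeriv_commutator hT hx hw hz hxw hts
  rw [← cw, ← cz, map_sub, map_sub, sub_apply, sub_apply,
    h.metric_symm (hxw t s hts) _ (w t s), h.metric_symm (hxw t s hts) _ (w t s)]
  have key' : g (Dl (Dr w)) z t s + g (Dr w) (Dl z) t s + (g (Dl w) (Dr z) t s + g w (Dl (Dr z)) t s)
      = g (Dr (Dl w)) z t s + g (Dl w) (Dr z) t s + (g (Dr w) (Dl z) t s + g w (Dr (Dl z)) t s) := by
    linarith
  have key'' : g (Dl (Dr w)) z t s - g (Dr (Dl w)) z t s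
      = -(g w (Dl (Dr z)) t s - g w (Dr (Dl z)) t s) := by linarith
  exact key''

end IsLocalFinsler

/-! ### Pseudo-Finsler metrics in coordinates -/

/-- Used to carry nondegeneracy from a tangent space to its coordinate expression in a chart. -/
theorem fiberMetric_comp_linear {E : Type*} [NormedAddCommGroup E] [NormedSpace ℝ E] (f : E → ℝ)
    (A : E ≃L[ℝ] E) (y u w : E) (hf : ContDiffAt ℝ ∞ f (A y)) :
    fiberMetric (fun z => f (A z)) y u w = fiberMetric f (A y) (A u) (A w) := by
  have e : fderiv ℝ (fun z => f (A z))
      = fun z => (fderiv ℝ f (A z)).comp (A : E →L[ℝ] E) := by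
    funext z
    exact A.comp_right_fderiv (f := f)
  have hd : HasFDerivAt (fderiv ℝ f) (fderiv ℝ (fderiv ℝ f) (A y)) (A y) :=
    ((contDiffAt_fderiv_infty hf).differentiableAt (by simp)).hasFDerivAt
  have h1 : HasFDerivAt (fun z => fderiv ℝ f (A z)) _ y := hd.comp y A.hasFDerivAt
  have h2 := h1.clm_comp (hasFDerivAt_const (A : E →L[ℝ] E) y)
  rw [fiberMetric, e, h2.fderiv]
  simp [fiberMetric]

section Coordinates

variable {E : Type*} [NormedAddCommGroup E] [NormedSpace ℝ E]
  {M : Type*} [TopologicalSpace M] [ChartedSpace E M] [IsManifold 𝓘(ℝ, E) ∞ M]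

/-- The isomorphism taking a tangent vector at `q` to its components in the preferred chart at
`p`. -/
noncomputable def compsEquiv (p q : M) (hq : q ∈ (chartAt E p).source) : E ≃L[ℝ] E :=
  (trivializationAt E (TangentSpace 𝓘(ℝ, E)) p).continuousLinearEquivAt ℝ q hq

theorem comps_eq_mfderiv (p q : M) (hq : q ∈ (chartAt E p).source) (v : TangentSpace 𝓘(ℝ, E) q) :
    comps p ⟨q, v⟩ = mfderiv 𝓘(ℝ, E) 𝓘(ℝ, E) (extChartAt 𝓘(ℝ, E) p) q v := by
  have := TangentBundle.continuousLinearMapAt_trivializationAt (I := 𝓘(ℝ, E)) hq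
  rw [← this]
  exact congrFun (Bundle.Trivialization.coe_continuousLinearEquivAt_eq (R := ℝ)
    (trivializationAt E (TangentSpace 𝓘(ℝ, E)) p) hq) v

/-- The tangent space at `p` is identified with `E` through the preferred chart at `p`, so taking
components over `p` itself changes nothing. Tensors at `p` can therefore be compared with their
coordinate expressions without any change of chart. -/
theorem comps_self (p : M) (v : TangentSpace 𝓘(ℝ, E) p) : comps p ⟨p, v⟩ = v := by
  rw [comps_eq_mfderiv p p (mem_chart_source E p), mfderiv_extChartAt_self]
  rfl

theorem ofComps_comps (p q : M) (hq : q ∈ (chartAt E p).source) (v : TangentSpace 𝓘(ℝ, E) q) :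
    ofComps p q (comps p ⟨q, v⟩) = v :=
  (compsEquiv p q hq).symm_apply_apply v

theorem ofComps_self (p : M) (y : E) : ofComps p p y = y := by
  have h := ofComps_comps p p (mem_chart_source E p) y
  have h' : comps p ⟨p, y⟩ = y := comps_self p y
  rwa [h'] at h

theorem contMDiffOn_ofComps (p : M) :
    ContMDiffOn (𝓘(ℝ, E × E)) 𝓘(ℝ, E).tangent ∞
      (fun q : E × E => (⟨(extChartAt 𝓘(ℝ, E) p).symm q.1,
        ofComps p ((extChartAt 𝓘(ℝ, E) p).symm q.1) q.2⟩ : TangentBundle 𝓘(ℝ, E) M))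
      ((extChartAt 𝓘(ℝ, E) p).target ×ˢ univ) := by
  have h1 := (trivializationAt E (TangentSpace 𝓘(ℝ, E)) p).contMDiffOn_symm (n := ∞)
    (IB := 𝓘(ℝ, E))
  have h2 : ContMDiffOn 𝓘(ℝ, E × E) (𝓘(ℝ, E).prod 𝓘(ℝ, E)) ∞
      (fun q : E × E => ((extChartAt 𝓘(ℝ, E) p).symm q.1, q.2))
      ((extChartAt 𝓘(ℝ, E) p).target ×ˢ univ) := by
    refine ContMDiffOn.prodMk ?_ contDiff_snd.contMDiff.contMDiffOn
    exact (contMDiffOn_extChartAt_symm (I := 𝓘(ℝ, E)) (n := ∞) p).comp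
      contDiff_fst.contMDiff.contMDiffOn fun q hq => hq.1
  have hsrc : ∀ x ∈ (extChartAt 𝓘(ℝ, E) p).target,
      (extChartAt 𝓘(ℝ, E) p).symm x ∈ (chartAt E p).source := fun x hx => by
    have := (extChartAt 𝓘(ℝ, E) p).map_target hx
    rwa [extChartAt_source] at this
  refine (h1.comp h2 fun q hq => ?_).congr fun q hq => ?_
  · exact ((trivializationAt E (TangentSpace 𝓘(ℝ, E)) p).mem_target).2 (hsrc q.1 hq.1)
  · exact Bundle.Trivialization.mk_symm _ (hsrc q.1 hq.1) q.2

namespace PseudoFinsler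

variable (F : PseudoFinsler E M)

/-- The conic domain in the coordinates of the preferred chart at `p`. -/
def coordDomain (p : M) : Set (E × E) :=
  {q | q.1 ∈ (extChartAt 𝓘(ℝ, E) p).target ∧ (⟨(extChartAt 𝓘(ℝ, E) p).symm q.1,
    ofComps p ((extChartAt 𝓘(ℝ, E) p).symm q.1) q.2⟩ : TangentBundle 𝓘(ℝ, E) M) ∈ F.A}

theorem isOpen_coordDomain (p : M) : IsOpen (F.coordDomain p) := by
  have h := (contMDiffOn_ofComps (E := E) p).continuousOn.isOpen_inter_preimage
    ((isOpen_extChartAt_target (I := 𝓘(ℝ, E)) p).prod isOpen_univ) F.isOpen_A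
  convert h using 1
  ext q
  simp [coordDomain]

theorem contDiffOn_coordL (p : M) :
    ContDiffOn ℝ ∞ (Function.uncurry (F.coordL p)) (F.coordDomain p) := by
  rw [← contMDiffOn_iff_contDiffOn]
  exact F.smooth.comp ((contMDiffOn_ofComps (E := E) p).mono fun q hq => ⟨hq.1, mem_univ _⟩)
    fun q hq => hq.2

theorem mem_coordDomain (p q : M) (hq : q ∈ (chartAt E p).source) (v : TangentSpace 𝓘(ℝ, E) q)
    (hv : (⟨q, v⟩ : TangentBundle 𝓘(ℝ, E) M) ∈ F.A) :
    (extChartAt 𝓘(ℝ, E) p q, comps p ⟨q, v⟩) ∈ F.coordDomain p := by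
  have hq' : q ∈ (extChartAt 𝓘(ℝ, E) p).source := by rwa [extChartAt_source]
  refine ⟨(extChartAt 𝓘(ℝ, E) p).map_source hq', ?_⟩
  simp only
  rw [(extChartAt 𝓘(ℝ, E) p).left_inv hq', ofComps_comps p q hq]
  exact hv

theorem coordL_self (p : M) :
    F.coordL p (extChartAt 𝓘(ℝ, E) p p) = fun y : E => F.L ⟨p, y⟩ := by
  funext y
  unfold coordL
  rw [extChartAt_to_inv, ofComps_self]

theorem contDiffAt_fiber {p : M} {v : E}
    (hv : (⟨p, v⟩ : TangentBundle 𝓘(ℝ, E) M) ∈ F.A) :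
    ContDiffAt ℝ ∞ (fun y : E => F.L ⟨p, y⟩) v := by
  have hm := F.mem_coordDomain p p (mem_chart_source E p) v hv
  have hc : comps p ⟨p, v⟩ = v := comps_self p v
  rw [hc] at hm
  rw [← F.coordL_self p]
  exact ((F.contDiffOn_coordL p).contDiffAt ((F.isOpen_coordDomain p).mem_nhds hm)).comp
    v (contDiffAt_const.prodMk contDiffAt_id)

/-- Over each base point the passage to components is a linear isomorphism of the fibre, which
respects both homogeneity and nondegeneracy. -/
theorem isLocalFinsler_coordL (p : M) : IsLocalFinsler (F.coordDomain p) (F.coordL p) where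
  isOpen := F.isOpen_coordDomain p
  smooth := F.contDiffOn_coordL p
  homogeneous x y hxy c hc := by
    have hq : (extChartAt 𝓘(ℝ, E) p).symm x ∈ (chartAt E p).source := by
      have := (extChartAt 𝓘(ℝ, E) p).map_target hxy.1
      rwa [extChartAt_source] at this
    have e : ofComps p ((extChartAt 𝓘(ℝ, E) p).symm x) (c • y)
        = c • ofComps p ((extChartAt 𝓘(ℝ, E) p).symm x) y :=
      (compsEquiv p _ hq).symm.map_smul c y
    unfold coordL
    rw [e]
    exact F.homogeneous _ _ c hc hxy.2
  nondegenerate x y hxy u hu := by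
    have hq : (extChartAt 𝓘(ℝ, E) p).symm x ∈ (chartAt E p).source := by
      have := (extChartAt 𝓘(ℝ, E) p).map_target hxy.1
      rwa [extChartAt_source] at this
    set q := (extChartAt 𝓘(ℝ, E) p).symm x
    let A : E ≃L[ℝ] E := (compsEquiv p q hq).symm
    have hA : (⟨q, A y⟩ : TangentBundle 𝓘(ℝ, E) M) ∈ F.A := hxy.2
    have hz : A u = 0 := by
      refine F.nondegenerate q (A y) hA (A u) fun w => ?_
      have h1 := hu (A.symm w)
      have h2 := fiberMetric_comp_linear (fun z : E => F.L ⟨q, z⟩) A y u (A.symm w)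
        (F.contDiffAt_fiber hA)
      rw [A.apply_symm_apply] at h2
      exact h2.symm.trans h1
    exact (map_eq_zero_iff A A.injective).1 hz

theorem g_eq {p : M} (v u w : TangentSpace 𝓘(ℝ, E) p) :
    F.g v u w = fiberMetric (F.coordL p (extChartAt 𝓘(ℝ, E) p p)) (comps p ⟨p, v⟩)
      (comps p ⟨p, u⟩) (comps p ⟨p, w⟩) := by
  rw [F.coordL_self, comps_self, comps_self, comps_self]
  rfl

end PseudoFinsler

/-! ### The tensor `B` -/

omit [IsManifold 𝓘(ℝ, E) ∞ M] in
theorem dirDeriv_congr {G : Type*} [NormedAddCommGroup G] [NormedSpace ℝ G] {f f' : M → G} {p : M}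
    (hf : f =ᶠ[𝓝 p] f') (X : TangentSpace 𝓘(ℝ, E) p) : dirDeriv f p X = dirDeriv f' p X :=
  congrArg (fun T : E →L[ℝ] G => T X) hf.mfderiv_eq

omit [IsManifold 𝓘(ℝ, E) ∞ M] in
theorem dirDeriv_eq_zero {f : M → ℝ} {p : M} (hf : ∀ᶠ q in 𝓝 p, f q = 0)
    (X : TangentSpace 𝓘(ℝ, E) p) : dirDeriv f p X = 0 := by
  have e : f =ᶠ[𝓝 p] fun _ => (0 : ℝ) := hf
  rw [dirDeriv_congr e]
  exact congrArg (fun T : E →L[ℝ] ℝ => T X) mfderiv_const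

namespace PseudoFinsler

variable (F : PseudoFinsler E M)

theorem C_symm_left {p : M} {v : TangentSpace 𝓘(ℝ, E) p}
    (hv : (⟨p, v⟩ : TangentBundle 𝓘(ℝ, E) M) ∈ F.A) (u₁ u₂ u₃ : TangentSpace 𝓘(ℝ, E) p) :
    F.C v u₁ u₂ u₃ = F.C v u₂ u₁ u₃ :=
  fiberCartan_symm_left (F.contDiffAt_fiber hv) u₁ u₂ u₃

theorem C_symm_right {p : M} {v : TangentSpace 𝓘(ℝ, E) p}
    (hv : (⟨p, v⟩ : TangentBundle 𝓘(ℝ, E) M) ∈ F.A) (u₁ u₂ u₃ : TangentSpace 𝓘(ℝ, E) p) :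
    F.C v u₁ u₂ u₃ = F.C v u₁ u₃ u₂ :=
  fiberCartan_symm_right (F.contDiffAt_fiber hv) u₁ u₂ u₃

theorem C_self_right {p : M} {v : TangentSpace 𝓘(ℝ, E) p}
    (hv : (⟨p, v⟩ : TangentBundle 𝓘(ℝ, E) M) ∈ F.A) (u₁ u₂ : TangentSpace 𝓘(ℝ, E) p) :
    F.C v u₁ u₂ v = 0 := by
  have hm := F.mem_coordDomain p p (mem_chart_source E p) v hv
  rw [comps_self] at hm
  have := (F.isLocalFinsler_coordL p).cartan_self_right hm u₁ u₂
  rwa [F.coordL_self] at this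

theorem nabla_congr {V X Y Y' : ∀ p : M, TangentSpace 𝓘(ℝ, E) p} {p : M}
    (hY : ∀ᶠ q in 𝓝 p, Y q = Y' q) : F.nabla V X Y p = F.nabla V X Y' p := by
  have e : (fun q => comps p ⟨q, Y q⟩) =ᶠ[𝓝 p] fun q => comps p ⟨q, Y' q⟩ := by
    filter_upwards [hY] with q hq
    rw [hq]
  unfold nabla
  rw [dirDeriv_congr e, hY.self_of_nhds]

theorem nabla_congr_left {V X X' Y : ∀ p : M, TangentSpace 𝓘(ℝ, E) p} {p : M}
    (hX : X p = X' p) : F.nabla V X Y p = F.nabla V X' Y p := by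
  unfold nabla
  rw [hX]

theorem nabla_zero_left {V X Y : ∀ p : M, TangentSpace 𝓘(ℝ, E) p} {p : M}
    (hX : X p = 0) : F.nabla V X Y p = 0 := by
  have hc : comps p ⟨p, (0 : TangentSpace 𝓘(ℝ, E) p)⟩ = 0 :=
    (compsEquiv p p (mem_chart_source E p)).map_zero
  have hd : dirDeriv (fun q => comps p ⟨q, Y q⟩) p (0 : TangentSpace 𝓘(ℝ, E) p) = 0 :=
    map_zero (mfderiv 𝓘(ℝ, E) 𝓘(ℝ, E) (fun q => comps p ⟨q, Y q⟩) p)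
  unfold nabla
  rw [hX, hc, christoffel_zero_left, hd, add_zero]
  exact (compsEquiv p p (mem_chart_source E p)).symm.map_zero

variable {Ω : Set M} {V : ∀ p : M, TangentSpace 𝓘(ℝ, E) p} (hΩ : IsOpen Ω)
  (hV : ∀ p ∈ Ω, (⟨p, V p⟩ : TangentBundle 𝓘(ℝ, E) M) ∈ F.A)
  {X Y Z W : ∀ p : M, TangentSpace 𝓘(ℝ, E) p}
include hΩ hV

/-- `C_V(Y, Z, V)` is zero on all of `Ω`, hence so is its derivative. Of the three correction terms
only the one that differentiates the last argument loses its `V`. -/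
theorem nablaCartan_self_right (hW : ∀ p ∈ Ω, W p = V p) {p : M} (hp : p ∈ Ω) :
    F.nablaCartan V X Y Z W p = - F.C (V p) (Y p) (Z p) (F.nabla V X V p) := by
  have hn := hΩ.mem_nhds hp
  have h0 : dirDeriv (fun q => F.C (V q) (Y q) (Z q) (W q)) p (X p) = 0 := by
    refine dirDeriv_eq_zero ?_ _
    filter_upwards [hn] with q hq
    rw [hW q hq, F.C_self_right (hV q hq)]
  have h1 : F.nabla V X W p = F.nabla V X V p := by
    refine F.nabla_congr ?_
    filter_upwards [hn] with q hq using hW q hq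
  unfold nablaCartan
  rw [h0, h1, hW p hp, F.C_self_right (hV p hp), F.C_self_right (hV p hp)]
  ring

/-- The two derivative terms reduce to `C_V(∇_X V, Z, ∇_Y V)` with opposite signs, up to permuting
arguments, and the curvature term contains `V`. -/
theorem B_self_right (hW : ∀ p ∈ Ω, W p = V p) {p : M} (hp : p ∈ Ω) :
    F.B V X Y Z W p = 0 := by
  unfold B
  rw [F.nablaCartan_self_right hΩ hV hW hp, F.nablaCartan_self_right hΩ hV hW hp, hW p hp,
    F.C_self_right (hV p hp), F.C_symm_right (hV p hp) (F.nabla V X V p),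
    F.C_symm_right (hV p hp) (F.nabla V Y V p), F.C_symm_left (hV p hp) (F.nabla V X V p)]
  ring

theorem nablaCartan_symm_right {p : M} (hp : p ∈ Ω) :
    F.nablaCartan V X Y Z W p = F.nablaCartan V X Y W Z p := by
  have e : (fun q => F.C (V q) (Y q) (Z q) (W q)) =ᶠ[𝓝 p]
      fun q => F.C (V q) (Y q) (W q) (Z q) := by
    filter_upwards [hΩ.mem_nhds hp] with q hq using F.C_symm_right (hV q hq) _ _ _
  unfold nablaCartan
  rw [dirDeriv_congr e, F.C_symm_right (hV p hp) _ (Z p) (W p),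
    F.C_symm_right (hV p hp) _ (F.nabla V X Z p) (W p),
    F.C_symm_right (hV p hp) _ (Z p) (F.nabla V X W p)]
  ring

theorem B_symm_right {p : M} (hp : p ∈ Ω) : F.B V X Y Z W p = F.B V X Y W Z p := by
  unfold B
  rw [F.nablaCartan_symm_right hΩ hV hp, F.nablaCartan_symm_right hΩ hV (X := X) hp,
    F.C_symm_right (hV p hp)]

omit hV in
-- Skewness of `B` in its first two arguments: the common value `V` serves only to make `X` and `Y`
-- equal. They must agree near `p` and not just at `p`, because `∇_X V` and `∇_Y V` are
-- differentiated again and the bracket depends on germs.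
theorem B_self_left (hX : ∀ p ∈ Ω, X p = V p) (hY : ∀ p ∈ Ω, Y p = V p) {p : M} (hp : p ∈ Ω) :
    F.B V X Y Z W p = 0 := by
  have hn := hΩ.mem_nhds hp
  have hXY : X p = Y p := (hX p hp).trans (hY p hp).symm
  have hnab : ∀ᶠ q in 𝓝 p, F.nabla V X V q = F.nabla V Y V q := by
    filter_upwards [hn] with q hq
    exact F.nabla_congr_left ((hX q hq).trans (hY q hq).symm)
  have hbr : VectorField.mlieBracket 𝓘(ℝ, E) Y X p = 0 := by
    have e : X =ᶠ[𝓝 p] Y := by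
      filter_upwards [hn] with q hq using (hX q hq).trans (hY q hq).symm
    rw [Filter.EventuallyEq.mlieBracket_vectorField_eq (Filter.EventuallyEq.refl _ Y) e,
      VectorField.mlieBracket_self]
    rfl
  have hR : F.curv V Y X V p = 0 := by
    unfold curv
    rw [F.nabla_zero_left hbr, F.nabla_congr hnab, F.nabla_congr_left hXY, sub_self, sub_zero]
  have e : (fun q => F.C (V q) (F.nabla V X V q) (Z q) (W q)) =ᶠ[𝓝 p]
      fun q => F.C (V q) (F.nabla V Y V q) (Z q) (W q) := by
    filter_upwards [hnab] with q hq
    rw [hq]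
  have hN : F.nablaCartan V Y (F.nabla V X V) Z W p = F.nablaCartan V X (F.nabla V Y V) Z W p := by
    unfold nablaCartan
    rw [dirDeriv_congr e, F.nabla_congr hnab, hnab.self_of_nhds, F.nabla_congr_left (Y := Z) hXY,
      F.nabla_congr_left (Y := W) hXY, F.nabla_congr_left (Y := F.nabla V Y V) hXY, hXY]
  unfold B
  rw [hN, hR, sub_self, zero_add]
  exact congrArg (fun T : E →L[ℝ] E →L[ℝ] ℝ => T (Z p) (W p))
    (map_zero (fiberCartan (fun y : E => F.L ⟨p, y⟩) (V p)))

end PseudoFinsler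

end Coordinates

/-! ### Variations in coordinates -/

section Variations

variable {E : Type*} [NormedAddCommGroup E] [NormedSpace ℝ E]
  {M : Type*} [TopologicalSpace M] [ChartedSpace E M] [IsManifold 𝓘(ℝ, E) ∞ M]

/-- Chain rule for the chart. Derivatives are taken within `J`, so that one-sided velocities at end
points are covered. -/
theorem comps_mfderivWithin (p : M) {c : ℝ → M} {J : Set ℝ} {t : ℝ}
    (hc : MDifferentiableWithinAt 𝓘(ℝ, ℝ) 𝓘(ℝ, E) c J t) (hJ : UniqueDiffWithinAt ℝ J t)
    (ht : c t ∈ (chartAt E p).source) :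
    comps p ⟨c t, mfderivWithin 𝓘(ℝ, ℝ) 𝓘(ℝ, E) c J t (1 : ℝ)⟩
      = derivWithin (fun τ => extChartAt 𝓘(ℝ, E) p (c τ)) J t := by
  rw [comps_eq_mfderiv p (c t) ht]
  have h1 := mfderiv_comp_mfderivWithin (I := 𝓘(ℝ, ℝ)) (I' := 𝓘(ℝ, E)) (I'' := 𝓘(ℝ, E)) t
    (mdifferentiableAt_extChartAt (I := 𝓘(ℝ, E)) ht) hc hJ.uniqueMDiffWithinAt
  rw [mfderivWithin_eq_fderivWithin] at h1
  have h2 := congrArg (fun T : ℝ →L[ℝ] E => T 1) h1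
  exact h2.symm

theorem contMDiffOn_comps (p : M) :
    ContMDiffOn 𝓘(ℝ, E).tangent 𝓘(ℝ, E) ∞ (comps (E := E) p)
      {v : TangentBundle 𝓘(ℝ, E) M | v.proj ∈ (chartAt E p).source} := by
  have h := (trivializationAt E (TangentSpace 𝓘(ℝ, E)) p).contMDiffOn (n := ∞) (IB := 𝓘(ℝ, E))
  have h' := contMDiff_snd.comp_contMDiffOn h
  refine h'.mono fun v hv => ?_
  exact ((trivializationAt E (TangentSpace 𝓘(ℝ, E)) p).mem_source).2 hv

namespace PseudoFinsler

variable (F : PseudoFinsler E M)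

/-- The base point of the chart is a separate variable `p`, so that the chart at `γ t` can be used,
although `γ t` and `Λ t 0` are equal only by hypothesis. -/
theorem comps_curvVariation {a b ε : ℝ} {Λ : ℝ → ℝ → M}
    (Z : ∀ t s : ℝ, TangentSpace 𝓘(ℝ, E) (Λ t s)) {t s : ℝ} {p : M} (hp : p = Λ t s)
    {x w z : ℝ → ℝ → E} (hx : x = fun t' s' => extChartAt 𝓘(ℝ, E) p (Λ t' s'))
    (hw : w = fun t' s' => comps p ⟨Λ t' s', velocity a b (fun τ => Λ τ s') t'⟩)
    (hz : z = fun t' s' => comps p ⟨Λ t' s', Z t' s'⟩) :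
    comps p ⟨Λ t s, F.curvVariation a b ε Λ Z t s⟩
      = covDerivCoord (F.coordL p) (Icc a b) (fun τ => x τ s) (fun τ => w τ s)
          (fun τ => covDerivCoord (F.coordL p) (Ioo (-ε) ε) (x τ) (w τ) (z τ) s) t
        - covDerivCoord (F.coordL p) (Ioo (-ε) ε) (x t) (w t)
          (fun σ => covDerivCoord (F.coordL p) (Icc a b) (fun τ => x τ σ) (fun τ => w τ σ)
            (fun τ => z τ σ) t) s := by
  subst hp hx hw hz
  rw [comps_self]
  exact ofComps_self _ _

variable [FiniteDimensional ℝ E]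

/-- `R^γ(γ', U) Z` in coordinates, and its skew-symmetry. -/
theorem IsCurvAlong.coord {a b : ℝ} {γ : ℝ → M} {U Z R : ∀ t : ℝ, TangentSpace 𝓘(ℝ, E) (γ t)}
    (hab : a < b) (h : F.IsCurvAlong a b γ U Z R) {t : ℝ} (ht : t ∈ Icc a b)
    {ξ : ℝ → E} (hξ : ξ = fun τ => extChartAt 𝓘(ℝ, E) (γ t) (γ τ))
    {ρ : E → E} (hρ : ρ = curvCoord (F.coordL (γ t)) (ξ t) (derivWithin ξ (Icc a b) t)
      (derivWithin ξ (Icc a b) t) (derivWithin (derivWithin ξ (Icc a b)) (Icc a b) t)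
      (comps (γ t) ⟨γ t, U t⟩)
      (derivWithin (fun τ => comps (γ t) ⟨γ τ, U τ⟩) (Icc a b) t)) :
    comps (γ t) ⟨γ t, R t⟩ = ρ (comps (γ t) ⟨γ t, Z t⟩) ∧
      fiberMetric (F.coordL (γ t) (ξ t)) (derivWithin ξ (Icc a b) t)
          (ρ (derivWithin ξ (Icc a b) t)) (comps (γ t) ⟨γ t, Z t⟩)
        = - fiberMetric (F.coordL (γ t) (ξ t)) (derivWithin ξ (Icc a b) t)
          (ρ (comps (γ t) ⟨γ t, Z t⟩)) (derivWithin ξ (Icc a b) t) := by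
  obtain ⟨ε, Λ, Z', hε, hΛ, hZ', hadm, hbd⟩ := h
  have h0 : (0 : ℝ) ∈ Ioo (-ε) ε := ⟨by linarith, hε⟩
  have hΛγ : ∀ τ ∈ Icc a b, Λ τ 0 = γ τ := fun τ hτ =>
    congrArg TotalSpace.proj (hbd τ hτ).1
  -- Restrict to the parameters whose image stays in the chart at `γ t`; by continuity they form a
  -- relatively open set.
  obtain ⟨O, hO, hOeq⟩ := (continuousOn_iff'.1 hΛ.continuousOn) (chartAt E (γ t)).source
    (chartAt E (γ t)).open_source
  have hT := isPatch_inter (ε := ε) hab hO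
  set T := (Icc a b ×ˢ Ioo (-ε) ε) ∩ O with hTdef
  have memT : ∀ t' s', (t', s') ∈ T ↔
      (t' ∈ Icc a b ∧ s' ∈ Ioo (-ε) ε) ∧ Λ t' s' ∈ (chartAt E (γ t)).source := by
    intro t' s'
    have := Set.ext_iff.1 hOeq (t', s')
    simp only [mem_inter_iff, mem_preimage, mem_prod] at this
    rw [hTdef, mem_inter_iff, mem_prod]
    tauto
  have htT : (t, (0 : ℝ)) ∈ T := (memT t 0).2 ⟨⟨ht, h0⟩, by
    rw [hΛγ t ht]; exact mem_chart_source E (γ t)⟩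
  set J := Icc a b with hJdef
  set K := Ioo (-ε) ε with hKdef
  obtain ⟨x, hxdef⟩ : ∃ x : ℝ → ℝ → E,
    x = fun t' s' => extChartAt 𝓘(ℝ, E) (γ t) (Λ t' s') := ⟨_, rfl⟩
  obtain ⟨w, hwdef⟩ : ∃ w : ℝ → ℝ → E,
    w = fun t' s' => comps (γ t) ⟨Λ t' s', velocity a b (fun τ => Λ τ s') t'⟩ := ⟨_, rfl⟩
  obtain ⟨z, hzdef⟩ : ∃ z : ℝ → ℝ → E,
    z = fun t' s' => comps (γ t) ⟨Λ t' s', Z' t' s'⟩ := ⟨_, rfl⟩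
  have hx : ContDiffOn ℝ ∞ (Function.uncurry x) T := by
    rw [← contMDiffOn_iff_contDiffOn, hxdef]
    exact (contMDiffOn_extChartAt (I := 𝓘(ℝ, E)) (x := γ t)).comp (hΛ.mono inter_subset_left)
      fun q hq => ((memT q.1 q.2).1 hq).2
  have hz : ContDiffOn ℝ ∞ (Function.uncurry z) T := by
    rw [← contMDiffOn_iff_contDiffOn, hzdef]
    exact (contMDiffOn_comps (γ t)).comp (hZ'.mono inter_subset_left)
      fun q hq => ((memT q.1 q.2).1 hq).2
  -- The reference vector is the longitudinal velocity, so its components are `∂_t x`. This provides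
  -- smoothness of `w` and, further on, its transverse derivative.
  have hwx : ∀ t' s', (t', s') ∈ T → w t' s' = pderivLeft J x t' s' := by
    intro t' s' hts
    obtain ⟨⟨h1, h2⟩, h3⟩ := (memT t' s').1 hts
    rw [hwdef, hxdef]
    exact comps_mfderivWithin (γ t) (c := fun τ => Λ τ s')
      (((hadm s' h2).1 t' h1).mdifferentiableWithinAt (by simp))
      (hT.uniqueDiffOn_left t' h1) h3
  have hw : ContDiffOn ℝ ∞ (Function.uncurry w) T :=
    (hT.contDiffOn_pderivLeft hx).congr fun q hq => hwx q.1 q.2 hq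
  have hxw : ∀ t' s', (t', s') ∈ T → (x t' s', w t' s') ∈ F.coordDomain (γ t) := by
    intro t' s' hts
    obtain ⟨⟨h1, h2⟩, h3⟩ := (memT t' s').1 hts
    rw [hxdef, hwdef]
    exact F.mem_coordDomain (γ t) _ h3 _ ((hadm s' h2).2 t' h1)
  have hLF := F.isLocalFinsler_coordL (γ t)
  have hcomm := hLF.covDeriv_commutator hT hx hw hz hxw htT
  have hskew := hLF.metric_commutator hT hx hw hz hxw htT
  rw [← F.comps_curvVariation Z' (hΛγ t ht).symm hxdef hwdef hzdef, (hbd t ht).2.2] at hcomm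
  have ex : ∀ τ ∈ J, x τ 0 = ξ τ := by
    intro τ hτ
    rw [hxdef, hξ]
    simp only
    rw [hΛγ τ hτ]
  have ez : z t 0 = comps (γ t) ⟨γ t, Z t⟩ := by
    rw [hzdef]
    exact congrArg (comps (γ t)) (hbd t ht).2.1
  have ex₁ : ∀ τ ∈ J, pderivLeft J x τ 0 = derivWithin ξ J τ := fun τ hτ =>
    derivWithin_congr ex (ex τ hτ)
  have ew : w t 0 = derivWithin ξ J t := (hwx t 0 htT).trans (ex₁ t ht)
  have ew₁ : pderivLeft J w t 0 = derivWithin (derivWithin ξ J) J t :=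
    (hT.pderivLeft_congr hwx htT).trans (derivWithin_congr ex₁ (ex₁ t ht))
  have ex₂ : ∀ τ, (τ, (0 : ℝ)) ∈ T → pderivRight K x τ 0 = comps (γ t) ⟨γ τ, U τ⟩ := by
    intro τ hτT
    obtain ⟨⟨h1, h2⟩, h3⟩ := (memT τ 0).1 hτT
    rw [← (hbd τ h1).1, hxdef]
    have hsl : ContMDiffOn 𝓘(ℝ, ℝ) 𝓘(ℝ, E) ∞ (fun σ => Λ τ σ) K :=
      hΛ.comp (f := fun σ : ℝ => (τ, σ)) (contDiff_prodMk_right τ).contMDiff.contMDiffOn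
        fun σ hσ => ⟨h1, hσ⟩
    have := comps_mfderivWithin (γ t) (c := fun σ => Λ τ σ)
      ((hsl 0 h2).mdifferentiableWithinAt (by simp)) (hT.uniqueDiffOn_right 0 h2) h3
    rw [mfderivWithin_of_isOpen isOpen_Ioo h2] at this
    exact this.symm
  have ew₂ : pderivRight K w t 0 = derivWithin (fun τ => comps (γ t) ⟨γ τ, U τ⟩) J t := by
    -- The step that removes dependence on the variation: `∂_s w = ∂_s ∂_t x = ∂_t ∂_s x`, and along
    -- `s = 0` the inner derivative is given by the components of `U`.
    rw [hT.pderivRight_congr hwx htT, ← hT.pderiv_comm hx htT]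
    refine Filter.EventuallyEq.derivWithin_eq ?_ (ex₂ t htT)
    filter_upwards [hT.slice_left t 0 htT] with τ hτ using ex₂ τ hτ
  rw [ex t ht, ew, ez, ex₁ t ht, ew₁, ex₂ t htT, ew₂] at hcomm hskew
  subst hρ
  exact ⟨hcomm, hskew⟩

/-- `R₁` and `R₂` may come from unrelated variations, but in the chart at `γ t` both are values of
the same map `ρ`, built from `γ` and `U` alone. The identity is then the skew-symmetry of `ρ`
obtained from the variation behind `R₂`. -/
theorem g_curv_skew {a b : ℝ} {γ : ℝ → M} {U P R₁ R₂ : ∀ t : ℝ, TangentSpace 𝓘(ℝ, E) (γ t)}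
    (hab : a < b) (hγ : F.AdmissibleCurve a b γ)
    (h₁ : F.IsCurvAlong a b γ U (velocity a b γ) R₁) (h₂ : F.IsCurvAlong a b γ U P R₂)
    {t : ℝ} (ht : t ∈ Icc a b) :
    F.g (velocity a b γ t) (R₁ t) (P t) = - F.g (velocity a b γ t) (R₂ t) (velocity a b γ t) := by
  obtain ⟨ξ, hξ⟩ : ∃ ξ : ℝ → E, ξ = fun τ => extChartAt 𝓘(ℝ, E) (γ t) (γ τ) := ⟨_, rfl⟩
  obtain ⟨ρ, hρ⟩ : ∃ ρ : E → E, ρ = curvCoord (F.coordL (γ t)) (ξ t) (derivWithin ξ (Icc a b) t)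
      (derivWithin ξ (Icc a b) t) (derivWithin (derivWithin ξ (Icc a b)) (Icc a b) t)
      (comps (γ t) ⟨γ t, U t⟩)
      (derivWithin (fun τ => comps (γ t) ⟨γ τ, U τ⟩) (Icc a b) t) := ⟨_, rfl⟩
  have hv : comps (γ t) ⟨γ t, velocity a b γ t⟩ = derivWithin ξ (Icc a b) t := by
    rw [hξ]
    exact comps_mfderivWithin (γ t) ((hγ.1 t ht).mdifferentiableWithinAt (by simp))
      (uniqueDiffOn_Icc hab t ht) (mem_chart_source E (γ t))
  have hx : extChartAt 𝓘(ℝ, E) (γ t) (γ t) = ξ t := by rw [hξ]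
  have e₁ := (IsCurvAlong.coord F hab h₁ ht hξ hρ).1
  obtain ⟨e₂, hs⟩ := IsCurvAlong.coord F hab h₂ ht hξ hρ
  rw [hv] at e₁
  rw [F.g_eq, F.g_eq, hx, hv, e₁, e₂]
  exact hs

end PseudoFinsler

end Variations

end FinslerGeom

/-! ### Assembly of the three assertions -/

theorem lemma3p10 {E : Type*} [NormedAddCommGroup E] [NormedSpace ℝ E] [FiniteDimensional ℝ E]
    {M : Type*} [TopologicalSpace M] [ChartedSpace E M] [IsManifold 𝓘(ℝ, E) ∞ M]
    (F : FinslerGeom.PseudoFinsler E M) :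
    (∀ (Ω : Set M) (V X Y Z W : ∀ p : M, TangentSpace 𝓘(ℝ, E) p),
      IsOpen Ω →
      FinslerGeom.SmoothField Ω V → FinslerGeom.SmoothField Ω X → FinslerGeom.SmoothField Ω Y →
      FinslerGeom.SmoothField Ω Z → FinslerGeom.SmoothField Ω W →
      (∀ p ∈ Ω, (⟨p, V p⟩ : TangentBundle 𝓘(ℝ, E) M) ∈ F.A) →
      (((∀ p ∈ Ω, Z p = V p) ∨ (∀ p ∈ Ω, W p = V p)) → ∀ p ∈ Ω, F.B V X Y Z W p = 0) ∧
      ((∃ i j : Fin 4, i ≠ j ∧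
          (∀ p ∈ Ω, (![X, Y, Z, W] i) p = V p) ∧ (∀ p ∈ Ω, (![X, Y, Z, W] j) p = V p)) →
        ∀ p ∈ Ω, F.B V X Y Z W p = 0)) ∧
    (∀ (a b : ℝ) (γ : ℝ → M) (U P R₁ R₂ : ∀ t : ℝ, TangentSpace 𝓘(ℝ, E) (γ t)),
      a < b → F.AdmissibleCurve a b γ →
      FinslerGeom.SmoothFieldAlong a b γ U → FinslerGeom.SmoothFieldAlong a b γ P →
      F.IsCurvAlong a b γ U (FinslerGeom.velocity a b γ) R₁ →
      F.IsCurvAlong a b γ U P R₂ →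
      ∀ t ∈ Icc a b,
        F.g (FinslerGeom.velocity a b γ t) (R₁ t) (P t)
          = - F.g (FinslerGeom.velocity a b γ t) (R₂ t) (FinslerGeom.velocity a b γ t)) := by
  refine ⟨fun Ω V X Y Z W hΩ _ _ _ _ _ hV => ?_, fun a b γ U P R₁ R₂ hab hγ _ _ h₁ h₂ t ht =>
    F.g_curv_skew hab hγ h₁ h₂ ht⟩
  have hW : (∀ p ∈ Ω, W p = V p) → ∀ p ∈ Ω, F.B V X Y Z W p = 0 :=
    fun h p hp => F.B_self_right hΩ hV h hp
  have hZ : (∀ p ∈ Ω, Z p = V p) → ∀ p ∈ Ω, F.B V X Y Z W p = 0 := fun h p hp =>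
    (F.B_symm_right hΩ hV hp).trans (F.B_self_right hΩ hV h hp)
  refine ⟨fun h => h.elim hZ hW, ?_⟩
  have hZW : ∀ k : Fin 4, k = 2 ∨ k = 3 → (∀ p ∈ Ω, (![X, Y, Z, W] k) p = V p) →
      ∀ p ∈ Ω, F.B V X Y Z W p = 0 := by
    rintro k (rfl | rfl) hk
    · exact hZ hk
    · exact hW hk
  rintro ⟨i, j, hij, hi, hj⟩
  by_cases hi' : i = 2 ∨ i = 3
  · exact hZW i hi' hi
  by_cases hj' : j = 2 ∨ j = 3
  · exact hZW j hj' hj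
  -- With `Z` and `W` excluded, two distinct positions can only be those of `X` and `Y`.
  have hcases : (i = 0 ∧ j = 1) ∨ (i = 1 ∧ j = 0) := by omega
  rcases hcases with ⟨rfl, rfl⟩ | ⟨rfl, rfl⟩
  · exact fun p hp => F.B_self_left hΩ hi hj hp
  · exact fun p hp => F.B_self_left hΩ hj hi hp
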